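/- Corollary 1 (Exponential Dominion-Decomposition Worst Case). A parity game consists of a finite directed graph in which every position has at least one successor, an owner in $\{0,1\}$ and a priority in $\mathbb{N}$; player $p$ wins an infinite play iff the largest priority occurring infinitely often has parity $p$. A subgame is a set $X$ of positions with the moves restricted to it. A $p$-dominion of $X$ is a set $D \subseteq X$ that the opponent $1-p$ cannot leave within $X$ and on which $p$ has a positional strategy that stays in $D$ and wins every consistent play. The $p$-attractor $\mathrm{attr}_p(U)$ is the set of positions from which $p$ can force the play within $X$ to reach $U$. For a bound $\ell : \mathbb{N} \to \mathbb{N}$, let the Recursive (McNaughton–Zielonka) algorithm with memoization, SCC decomposition and dominion decomposition be the following procedure, which computes the two winning regions $W_0, W_1$ of a subgame $X$. 1. If $X$ is recorded in the memoization table, return the recorded regions; if $X = \emptyset$, return $(\emptyset,\emptyset)$. In all other cases the computed regions of $X$ are recorded before they are returned. 2. If $X$ is not a single strongly connected component, choose a bottom component $C$, solve it recursively, remove from $X$ the attractors of the two players to their winning regions in $C$, solve the rest recursively, and let the winning regions of $X$ be the unions of the attractors and the regions won in the rest. 3. Otherwise test the nonempty subsets of $X$ of size at most $\ell(|X|)$,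 in an order of nondecreasing size, until a dominion is found. If a $p$-dominion $D$ is found, solve $X \setminus \mathrm{attr}_p(D)$ recursively; player $1-p$ wins in $X$ what it wins there, and $p$ wins the remaining positions of $X$. 4. If none is found, let $m$ be the maximal priority in $X$ and $p \equiv m \pmod 2$. Solve $X_L = X \setminus \mathrm{attr}_p(\{v \in X : v \text{ has priority } m\})$ recursively, and let $W$ be the region won there by $1-p$. If $1-p$ cannot force $W$ to be entered in one move from any position of $X \setminus W$, then $1-p$ wins $W$ and $p$ wins $X \setminus W$. Otherwise solve $X_R = X \setminus \mathrm{attr}_{1-p}(W)$ recursively; $p$ wins in $X$ what it wins in $X_R$, and $1-p$ wins the remaining positions of $X$. The solution time is measured by counting one step for each call (including those answered from the table) and one step for each candidate set tested in a search for dominions; all other work is free. Then the solution time is $\Omega(2^{\Theta(\sqrt{n})})$ in the worst case on games with $n$ positions: there is a constant $c > 0$ such that, for every sufficiently large $n$, there is a parity game with exactly $n$ positions on which, for every bound $\ell : \mathbb{N} \to \mathbb{N}$ (in particular $\ell(m) = \lceil \sqrt{m}\, \rceil$, and also $\ell = 0$, that is, no dominion search), the algorithm can run to termination, and every terminating run,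 however the bottom components and the order among candidates of equal size are chosen, takes at least $2^{c\sqrt{n}}$ steps. -/

import Mathlib

open Filter

/-- The two players: `false` is player `0` (Even), `true` is player `1` (Odd); the opponent of `p`
is `!p`, and `Nat.bodd m` is the player whose parity is that of `m`. -/
abbrev Player := Bool

/-- A parity game on the (finite) set of positions `V`: every position has an owner, a priority,
and at least one outgoing move. -/
structure ParityGame (V : Type) where
  owner : V → Player
  move : V → V → Prop
  total : ∀ v, ∃ w, move v w
  priority : V → ℕ

namespace ParityGame

variable {V : Type} [DecidableEq V] (G : ParityGame V)

/-- Player `p` wins the infinite play `π`: the largest priority seen infinitely often has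
parity `p`. -/
def Wins (p : Player) (π : ℕ → V) : Prop :=
  ∃ m : ℕ, m.bodd = p ∧ (∃ᶠ i in atTop, G.priority (π i) = m) ∧
    ∀ᶠ i in atTop, G.priority (π i) ≤ m

/-! Subgames of `G` are given by their sets of positions `X`, with the moves restricted to `X`. -/

/-- `D` is a `p`-dominion of the subgame `X`: the opponent has no move of `X` that leaves `D`, and
`p` has a positional strategy that stays in `D` and wins every play in `D` consistent with it. -/
def IsDominion (X : Finset V) (p : Player) (D : Finset V) : Prop :=
  D ⊆ X ∧
  (∀ v ∈ D, G.owner v ≠ p → ∀ w ∈ X, G.move v w → w ∈ D) ∧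
  ∃ σ : V → V, (∀ v ∈ D, G.owner v = p → G.move v (σ v) ∧ σ v ∈ D) ∧
    ∀ π : ℕ → V,
      (∀ i, π i ∈ D ∧ G.move (π i) (π (i + 1)) ∧
        (G.owner (π i) = p → π (i + 1) = σ (π i))) →
      G.Wins p π

open Classical in
/-- The positions of `X` from which `p` can force the subgame `X` into `U` with one move. -/
noncomputable def pre (X : Finset V) (p : Player) (U : Finset V) : Finset V :=
  X.filter fun v =>
    (G.owner v = p ∧ ∃ w ∈ X, G.move v w ∧ w ∈ U) ∨
    (G.owner v ≠ p ∧ ∀ w ∈ X, G.move v w → w ∈ U)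

/-- Membership in the `p`-attractor of `U` in the subgame `X`, the least set that contains
`U` (within `X`) and is closed under one-move predecessors for `p`. -/
inductive InAttr (X : Finset V) (p : Player) (U : Finset V) : V → Prop
  | base (v : V) : v ∈ X → v ∈ U → InAttr X p U v
  | own (v w : V) : v ∈ X → G.owner v = p → w ∈ X → G.move v w → InAttr X p U w →
      InAttr X p U v
  | opp (v : V) : v ∈ X → G.owner v ≠ p → (∀ w, w ∈ X → G.move v w → InAttr X p U w) →
      InAttr X p U v

open Classical in
/-- The `p`-attractor of `U` in the subgame `X`. -/
noncomputable def attr (X : Finset V) (p : Player) (U : Finset V) : Finset V :=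
  X.filter fun v => G.InAttr X p U v

/-- The maximal priority of the subgame `X`. -/
def maxPriority (X : Finset V) : ℕ := X.sup G.priority

/-- The positions of maximal priority of the subgame `X`. -/
def maxPositions (X : Finset V) : Finset V :=
  X.filter fun v => G.priority v = G.maxPriority X

/-- The player that has the parity of the maximal priority of `X`. -/
def leader (X : Finset V) : Player := (G.maxPriority X).bodd

/-- The subgame of the left recursive call: remove the attractor to the maximal priority. -/
noncomputable def leftGame (X : Finset V) : Finset V :=
  X \ G.attr X (G.leader X) (G.maxPositions X)

/-- The subgame of the right recursive call, where `U` is the region that the opponent of the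
leader wins in the left subgame. -/
noncomputable def rightGame (X U : Finset V) : Finset V :=
  X \ G.attr X (!G.leader X) U

/-- `C` is a bottom strongly connected component of the subgame `X`: a nonempty set of positions
such that from each of them exactly the positions of `C` are reachable in `X`.
In particular, `X` consists of a single component iff `G.IsBottomSCC X X`. -/
def IsBottomSCC (X C : Finset V) : Prop :=
  C.Nonempty ∧ C ⊆ X ∧
    ∀ v ∈ C, ∀ w, w ∈ C ↔ Relation.ReflTransGen (fun a b => a ∈ X ∧ b ∈ X ∧ G.move a b) v w

/-- `L` is an enumeration, by nondecreasing size and without repetitions, of the nonempty sets of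
at most `l` positions of `X`: the candidates of a brute-force search for a dominion. -/
def IsSearchOrder (X : Finset V) (l : ℕ) (L : List (Finset V)) : Prop :=
  L.Nodup ∧ (∀ S, S ∈ L ↔ S ⊆ X ∧ S.Nonempty ∧ S.card ≤ l) ∧
    L.Pairwise fun S T => S.card ≤ T.card

/-- A memoization table: it assigns to each recorded subgame its two winning regions. -/
abbrev Memo (V : Type) := Finset V → Option (Player → Finset V)

/-- The memoization table without records. -/
def Memo.empty : Memo V := fun _ => none

/-- Record the winning regions `W` of the subgame `X`. -/
def Memo.store (M : Memo V) (X : Finset V) (W : Player → Finset V) : Memo V :=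
  Function.update M X (some W)

/-- The pair of regions in which `p` is given `A` and the opponent of `p` is given `B`. -/
def regions (p : Player) (A B : Finset V) : Player → Finset V := fun q => if q = p then A else B

/-- The Recursive algorithm with memoization, SCC decomposition and dominion decomposition.
`G.Exec ℓ M X W M' t` says: called on the subgame `X` with memoization table `M`, it can return the
winning regions `W` and leave the table `M'`, after `t` steps.  A step is charged for each
(recursive) call and for each candidate set tested in a search for dominions; everything else is
free.  `ℓ m` is the maximal size of the dominions searched for in subgames with `m` positions.
The only choices left open are that of a bottom component and the order among candidate sets of
the same size. -/
inductive Exec (ℓ : ℕ → ℕ) :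
    Memo V → Finset V → (Player → Finset V) → Memo V → ℕ → Prop
  /-- The subgame is recorded in the table. -/
  | hit (M : Memo V) (X : Finset V) (W : Player → Finset V) :
      M X = some W → Exec ℓ M X W M 1
  /-- The subgame has no positions. -/
  | empty (M : Memo V) : M ∅ = none → Exec ℓ M ∅ (fun _ => ∅) M 1
  /-- The subgame is not a single component: solve a bottom component `C`, remove the attractors
  to its two winning regions, and solve the rest. -/
  | scc (M M₁ M₂ : Memo V) (X C : Finset V) (W₁ W₂ : Player → Finset V) (t₁ t₂ : ℕ) :
      M X = none → X.Nonempty → G.IsBottomSCC X C → C ≠ X →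
      Exec ℓ M C W₁ M₁ t₁ →
      Exec ℓ M₁ (X \ (G.attr X false (W₁ false) ∪ G.attr X true (W₁ true))) W₂ M₂ t₂ →
      Exec ℓ M X (fun p => G.attr X p (W₁ p) ∪ W₂ p)
        (M₂.store X fun p => G.attr X p (W₁ p) ∪ W₂ p) (1 + t₁ + t₂)
  /-- The search finds a dominion `D` of player `p` after the failed candidates `L₁`: remove the
  attractor to `D` and solve the rest. -/
  | dominion (M M₁ : Memo V) (X D : Finset V) (L₁ L₂ : List (Finset V)) (p : Player)
      (W₁ : Player → Finset V) (t₁ : ℕ) :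
      M X = none → X.Nonempty → G.IsBottomSCC X X →
      IsSearchOrder X (ℓ X.card) (L₁ ++ D :: L₂) →
      (∀ S ∈ L₁, ∀ q, ¬ G.IsDominion X q S) → G.IsDominion X p D →
      Exec ℓ M (X \ G.attr X p D) W₁ M₁ t₁ →
      Exec ℓ M X (regions p (X \ W₁ (!p)) (W₁ (!p)))
        (M₁.store X (regions p (X \ W₁ (!p)) (W₁ (!p)))) (1 + (L₁.length + 1) + t₁)
  /-- The search finds no dominion, and after the left call the opponent of the leader cannot
  extend the region won in the left subgame. -/
  | left (M M₁ : Memo V) (X : Finset V) (L : List (Finset V)) (W₁ : Player → Finset V) (t₁ : ℕ) :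
      M X = none → X.Nonempty → G.IsBottomSCC X X →
      IsSearchOrder X (ℓ X.card) L → (∀ S ∈ L, ∀ q, ¬ G.IsDominion X q S) →
      Exec ℓ M (G.leftGame X) W₁ M₁ t₁ →
      G.pre X (!G.leader X) (W₁ (!G.leader X)) \ W₁ (!G.leader X) = ∅ →
      Exec ℓ M X (regions (G.leader X) (X \ W₁ (!G.leader X)) (W₁ (!G.leader X)))
        (M₁.store X (regions (G.leader X) (X \ W₁ (!G.leader X)) (W₁ (!G.leader X))))
        (1 + L.length + t₁)
  /-- The search finds no dominion, and after the left call the opponent of the leader can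
  extend the region won in the left subgame, so that the right call is needed. -/
  | right (M M₁ M₂ : Memo V) (X : Finset V) (L : List (Finset V)) (W₁ W₂ : Player → Finset V)
      (t₁ t₂ : ℕ) :
      M X = none → X.Nonempty → G.IsBottomSCC X X →
      IsSearchOrder X (ℓ X.card) L → (∀ S ∈ L, ∀ q, ¬ G.IsDominion X q S) →
      Exec ℓ M (G.leftGame X) W₁ M₁ t₁ →
      G.pre X (!G.leader X) (W₁ (!G.leader X)) \ W₁ (!G.leader X) ≠ ∅ →
      Exec ℓ M₁ (G.rightGame X (W₁ (!G.leader X))) W₂ M₂ t₂ →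
      Exec ℓ M X (regions (G.leader X) (W₂ (G.leader X)) (X \ W₂ (G.leader X)))
        (M₂.store X (regions (G.leader X) (W₂ (G.leader X)) (X \ W₂ (G.leader X))))
        (1 + L.length + t₁ + t₂)

/-- `G.SolvedIn ℓ t`: the algorithm, started on the whole game with an empty memoization table, can
terminate after exactly `t` steps. -/
def SolvedIn [Fintype V] (ℓ : ℕ → ℕ) (t : ℕ) : Prop :=
  ∃ W M, G.Exec ℓ Memo.empty Finset.univ W M t

end ParityGame

namespace ParityGame

set_option linter.unusedSectionVars false

/-! ### Attractors and dominions. -/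

section General

variable {V : Type} [DecidableEq V] {G : ParityGame V}

/-! The hard game has a recursion that reaches exponentially many distinct subgames, so memoization
does not help, and it is inflated so that finding any dominion by brute force is itself
exponentially expensive.

The core game has two hubs and levels `a j`, `b j`, `c j`, `d j`. The hubs keep the relevant
subgames strongly connected, and only `a j` has a priority above 1, namely `j + 2`. With `a (i + 1)`
on top, the left call deletes exactly `a (i + 1)` and `b (i + 1)`. In the left subgame the opponent
of the leader wins exactly the pairs `c j`, `d j` with `j ≥ i + 1` of the parity of `i + 1`, because
the exit from `c j` to `a (j + 1)` is gone (`Stage.solves_leader`). If `c (i + 1)` is present, this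
region attracts `a (i + 1)` and `c i` but not `b (i + 1)`: the right call deletes `a (i + 1)` and
keeps `b (i + 1)`. Both calls leave level `i` on top. The right call loses `c i`, which a right call
on level `i` would need, so one free choice is made per two levels: left-left or right-left,
remembered by `b (2 * j)`. Thus `m` choices give `2 ^ m` recorded subgames (`exists_recorded`,
`two_pow_le_records`), each paid for by a step (`Exec.card_records`). Since all runs compute the
true winning regions (`Exec.correct`), their choices do not matter.

Inflation replaces each position by a path of `k = m + 1` positions. A nonempty dominion then
contains a whole path (`card_dominion`), and a search by nondecreasing size tests all its nonempty
proper subsets first (`IsSearchOrder.two_pow_le`). A run of fewer than `2 ^ k - 1` steps therefore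
never bypasses the forced calls, whatever `ℓ` is (`Exec.closed`). Having `2 * m + 1` levels and
paths of length `m + 1` gives order `m ^ 2` positions, whence the square root. Padding positions
without incoming moves adjust the size to exactly `n`. -/

theorem mem_attr {X U : Finset V} {p : Player} {v : V} :
    v ∈ G.attr X p U ↔ G.InAttr X p U v := by
  simp only [attr, Finset.mem_filter]
  refine ⟨fun h => h.2, fun h => ⟨?_, h⟩⟩
  cases h <;> assumption

theorem attr_subset (X U : Finset V) (p : Player) : G.attr X p U ⊆ X := fun v hv => by
  cases mem_attr.1 hv <;> assumption

theorem subset_attr {X U : Finset V} {p : Player} (h : U ⊆ X) : U ⊆ G.attr X p U :=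
  fun v hv => mem_attr.2 (.base v (h hv) hv)

theorem mem_pre_of_own {X U : Finset V} {p : Player} {v w : V} (hv : v ∈ X)
    (ho : G.owner v = p) (hw : w ∈ X) (hm : G.move v w) (hU : w ∈ U) : v ∈ G.pre X p U := by
  classical
  unfold pre
  rw [Finset.mem_filter]
  exact ⟨hv, .inl ⟨ho, w, hw, hm, hU⟩⟩

theorem mem_attr_of_own {X U : Finset V} {p : Player} {v w : V} (hv : v ∈ X)
    (ho : G.owner v = p) (hm : G.move v w) (hw : w ∈ G.attr X p U) : v ∈ G.attr X p U :=
  mem_attr.2 (.own v w hv ho (attr_subset _ _ _ hw) hm (mem_attr.1 hw))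

theorem mem_attr_of_opp {X U : Finset V} {p : Player} {v : V} (hv : v ∈ X)
    (ho : G.owner v ≠ p) (h : ∀ w ∈ X, G.move v w → w ∈ G.attr X p U) : v ∈ G.attr X p U :=
  mem_attr.2 (.opp v hv ho fun w hw hm => mem_attr.1 (h w hw hm))

theorem Wins.of_tail {p : Player} {π : ℕ → V} (n : ℕ) (h : G.Wins p fun i => π (i + n)) :
    G.Wins p π := by
  obtain ⟨m, hm, hf, he⟩ := h
  refine ⟨m, hm, ?_, ?_⟩
  · rw [← map_add_atTop_eq_nat n]
    exact hf
  · rw [← map_add_atTop_eq_nat n]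
    exact he

theorem not_wins_both {p : Player} {π : ℕ → V} (h : G.Wins p π) (h' : G.Wins (!p) π) : False := by
  obtain ⟨m, hm, hf, he⟩ := h
  obtain ⟨m', hm', hf', he'⟩ := h'
  have h1 : m ≤ m' := by
    obtain ⟨i, hi, hi'⟩ := (hf.and_eventually he').exists
    omega
  have h2 : m' ≤ m := by
    obtain ⟨i, hi, hi'⟩ := (hf'.and_eventually he).exists
    omega
  have : m = m' := le_antisymm h1 h2
  subst this
  rw [hm] at hm'
  cases p <;> simp at hm'

/-- Following both strategies at once produces a play that stays in both sets and would be won by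
both players. -/
theorem IsDominion.disjoint {X D E : Finset V} {p : Player} (hD : G.IsDominion X p D)
    (hE : G.IsDominion X (!p) E) {v : V} (h1 : v ∈ D) (h2 : v ∈ E) : False := by
  obtain ⟨hDX, hDc, σ, hσ, hσw⟩ := hD
  obtain ⟨hEX, hEc, τ, hτ, hτw⟩ := hE
  let s : V → V := fun u => if G.owner u = p then σ u else τ u
  have hs : ∀ u, u ∈ D ∧ u ∈ E → (s u ∈ D ∧ s u ∈ E) ∧ G.move u (s u) := by
    rintro u ⟨hu, hu'⟩
    by_cases ho : G.owner u = p
    · simp only [s, ho, if_true]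
      have := hσ u hu ho
      refine ⟨⟨this.2, hEc u hu' ?_ _ (hDX this.2) this.1⟩, this.1⟩
      rw [ho]; cases p <;> simp
    · simp only [s, ho, if_false]
      have ho' : G.owner u = !p := by
        revert ho; cases G.owner u <;> cases p <;> simp
      have := hτ u hu' ho'
      exact ⟨⟨hDc u hu ho _ (hEX this.2) this.1, this.2⟩, this.1⟩
  let π : ℕ → V := fun i => s^[i] v
  have hπ : ∀ i, π (i + 1) = s (π i) := fun i => Function.iterate_succ_apply' s i v
  have hin : ∀ i, π i ∈ D ∧ π i ∈ E := by
    intro i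
    induction i with
    | zero => exact ⟨h1, h2⟩
    | succ i ih => rw [hπ]; exact (hs _ ih).1
  refine not_wins_both (hσw π fun i => ⟨(hin i).1, ?_, ?_⟩) (hτw π fun i => ⟨(hin i).2, ?_, ?_⟩)
  · rw [hπ]; exact (hs _ (hin i)).2
  · intro ho; rw [hπ]; simp only [s, ho, if_true]
  · rw [hπ]; exact (hs _ (hin i)).2
  · intro ho; rw [hπ]
    have : G.owner (π i) ≠ p := by rw [ho]; cases p <;> simp
    simp only [s, this, if_false]

theorem isDominion_empty (X : Finset V) (p : Player) : G.IsDominion X p ∅ :=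
  ⟨by simp, by simp, id, by simp, fun π h => absurd (h 0).1 (by simp)⟩

/-- The strategy for `D` takes precedence: a play that ever enters `D` stays there, and any other
play follows the strategy for `E` forever. -/
theorem IsDominion.union {X Y D E : Finset V} {p : Player} (hD : G.IsDominion X p D)
    (hE : G.IsDominion Y p E) (hYX : Y ⊆ X)
    (h : ∀ v ∈ E, G.owner v ≠ p → ∀ w ∈ X, G.move v w → w ∈ Y ∨ w ∈ D) :
    G.IsDominion X p (D ∪ E) := by
  obtain ⟨hDX, hDc, σ, hσ, hσw⟩ := hD
  obtain ⟨hEY, hEc, τ, hτ, hτw⟩ := hE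
  refine ⟨Finset.union_subset hDX (hEY.trans hYX), ?_, fun v => if v ∈ D then σ v else τ v, ?_, ?_⟩
  · intro v hv ho w hw hm
    rw [Finset.mem_union] at hv ⊢
    rcases hv with hv | hv
    · exact .inl (hDc v hv ho w hw hm)
    · rcases h v hv ho w hw hm with h1 | h1
      · exact .inr (hEc v hv ho w h1 hm)
      · exact .inl h1
  · intro v hv ho
    rw [Finset.mem_union] at hv
    by_cases hvD : v ∈ D
    · simp only [hvD, if_true, Finset.mem_union]
      exact ⟨(hσ v hvD ho).1, .inl (hσ v hvD ho).2⟩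
    · have hvE := hv.resolve_left hvD
      simp only [hvD, if_false, Finset.mem_union]
      exact ⟨(hτ v hvE ho).1, .inr (hτ v hvE ho).2⟩
  · intro π hπ
    beta_reduce at hπ
    by_cases hex : ∃ n, π n ∈ D
    · obtain ⟨n, hn⟩ := hex
      have hin : ∀ i, π (i + n) ∈ D := by
        intro i
        induction i with
        | zero => simpa using hn
        | succ i ih =>
          obtain ⟨-, hm, ho⟩ := hπ (i + n)
          obtain ⟨h1, -, -⟩ := hπ (i + n + 1)
          rw [show i + 1 + n = i + n + 1 by omega]
          by_cases hp : G.owner (π (i + n)) = p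
          · rw [ho hp, if_pos ih]
            exact (hσ _ ih hp).2
          · refine hDc _ ih hp _ ?_ hm
            rcases Finset.mem_union.1 h1 with h1 | h1
            · exact hDX h1
            · exact hYX (hEY h1)
      refine Wins.of_tail n (hσw _ fun i => ⟨hin i, ?_, ?_⟩)
      · rw [show i + 1 + n = i + n + 1 by omega]; exact (hπ (i + n)).2.1
      · intro ho
        rw [show i + 1 + n = i + n + 1 by omega, (hπ (i + n)).2.2 ho, if_pos (hin i)]
    · push Not at hex
      refine hτw π fun i => ⟨?_, (hπ i).2.1, fun ho => ?_⟩
      · exact (Finset.mem_union.1 (hπ i).1).resolve_left (hex i)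
      · rw [(hπ i).2.2 ho, if_neg (hex i)]

theorem IsDominion.mono {X Y E : Finset V} {p : Player} (hE : G.IsDominion Y p E) (hYX : Y ⊆ X)
    (h : ∀ v ∈ E, G.owner v ≠ p → ∀ w ∈ X, G.move v w → w ∈ Y) : G.IsDominion X p E := by
  simpa using (isDominion_empty X p).union hE hYX fun v hv ho w hw hm => .inl (h v hv ho w hw hm)

/-- The positions from which `p` forces a visit to `U` within `n` moves. -/
def attrStage (G : ParityGame V) (X : Finset V) (p : Player) (U : Finset V) : ℕ → V → Prop
  | 0, v => v ∈ X ∧ v ∈ U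
  | n + 1, v => attrStage G X p U n v ∨ v ∈ X ∧
      ((G.owner v = p ∧ ∃ w ∈ X, G.move v w ∧ attrStage G X p U n w) ∨
        (G.owner v ≠ p ∧ ∀ w ∈ X, G.move v w → attrStage G X p U n w))

theorem attrStage_mono {X U : Finset V} {p : Player} {m n : ℕ} (h : m ≤ n) {v : V}
    (hv : attrStage G X p U m v) : attrStage G X p U n v := by
  induction h with
  | refl => exact hv
  | step _ ih => exact .inl ih

theorem InAttr.exists_stage {X U : Finset V} {p : Player} {v : V} (h : G.InAttr X p U v) :
    ∃ n, attrStage G X p U n v := by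
  induction h with
  | base v hv hu => exact ⟨0, hv, hu⟩
  | own v w hv ho hw hm _ ih =>
    obtain ⟨n, hn⟩ := ih
    exact ⟨n + 1, .inr ⟨hv, .inl ⟨ho, w, hw, hm, hn⟩⟩⟩
  | opp v hv ho _ ih =>
    choose! f hf using ih
    refine ⟨X.sup f + 1, .inr ⟨hv, .inr ⟨ho, fun w hw hm => ?_⟩⟩⟩
    exact attrStage_mono (Finset.le_sup hw) (hf w hw hm)

theorem attrStage.inAttr {X U : Finset V} {p : Player} {n : ℕ} {v : V}
    (h : attrStage G X p U n v) : G.InAttr X p U v := by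
  induction n generalizing v with
  | zero => exact .base v h.1 h.2
  | succ n ih =>
    rcases h with h | ⟨hv, ⟨ho, w, hw, hm, h⟩ | ⟨ho, h⟩⟩
    · exact ih h
    · exact .own v w hv ho hw hm (ih h)
    · exact .opp v hv ho fun w hw hm => ih (h w hw hm)

/-- The attractor strategy, with the rank that decreases along it. -/
theorem exists_attr_strategy (G : ParityGame V) (X : Finset V) (p : Player) (U : Finset V) :
    ∃ (α : V → V) (r : V → ℕ), ∀ v ∈ G.attr X p U, v ∉ U →
      (G.owner v = p → G.move v (α v) ∧ α v ∈ G.attr X p U ∧ r (α v) < r v) ∧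
      (G.owner v ≠ p → ∀ w ∈ X, G.move v w → w ∈ G.attr X p U ∧ r w < r v) := by
  classical
  let r : V → ℕ := fun v => if h : ∃ n, attrStage G X p U n v then Nat.find h else 0
  have hr : ∀ v n, attrStage G X p U n v → r v ≤ n := by
    intro v n h
    have hex : ∃ n, attrStage G X p U n v := ⟨n, h⟩
    simp only [r, dif_pos hex]
    exact Nat.find_le h
  have key : ∀ v ∈ G.attr X p U, v ∉ U →
      (G.owner v = p → ∃ w, G.move v w ∧ w ∈ G.attr X p U ∧ r w < r v) ∧
      (G.owner v ≠ p → ∀ w ∈ X, G.move v w → w ∈ G.attr X p U ∧ r w < r v) := by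
    intro v hv hU
    have hex := (mem_attr.1 hv).exists_stage
    have hrv : r v = Nat.find hex := by simp only [r, dif_pos hex]
    have hs := Nat.find_spec hex
    rcases hn : Nat.find hex with _ | n
    · rw [hn] at hs; exact absurd hs.2 hU
    · rw [hn] at hs
      have hlt : ¬ attrStage G X p U n v := Nat.find_min hex (by omega)
      rcases hs with hs | ⟨-, ⟨ho, w, hw, hm, h⟩ | ⟨ho, h⟩⟩
      · exact absurd hs hlt
      · refine ⟨fun _ => ⟨w, hm, mem_attr.2 h.inAttr, ?_⟩, fun h' => absurd ho h'⟩
        have := hr w n h; omega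
      · refine ⟨fun h' => absurd h' ho, fun _ w hw hm => ⟨mem_attr.2 (h w hw hm).inAttr, ?_⟩⟩
        have := hr w n (h w hw hm); omega
  choose! α hα using fun v (h : v ∈ G.attr X p U) (h' : v ∉ U) => (key v h h').1
  exact ⟨α, r, fun v hv hU => ⟨fun ho => hα v hv hU ho, (key v hv hU).2⟩⟩

theorem exists_visit {A U : Finset V} {r : V → ℕ} {π : ℕ → V}
    (h : ∀ i, π i ∈ A → π i ∉ U → π (i + 1) ∈ A ∧ r (π (i + 1)) < r (π i)) {i : ℕ}
    (hi : π i ∈ A) : ∃ j ≥ i, π j ∈ U := by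
  induction hn : r (π i) using Nat.strong_induction_on generalizing i with
  | _ n ih =>
    by_cases hU : π i ∈ U
    · exact ⟨i, le_rfl, hU⟩
    · obtain ⟨h1, h2⟩ := h i hi hU
      obtain ⟨j, hj, hjU⟩ := ih _ (hn ▸ h2) h1 rfl
      exact ⟨j, by omega, hjU⟩

/-- The attractor strategy reaches `D` after finitely many moves, and winning depends only on the
tail of a play. -/
theorem IsDominion.attr {X D : Finset V} {p : Player} (hD : G.IsDominion X p D) :
    G.IsDominion X p (G.attr X p D) := by
  obtain ⟨hDX, hDc, σ, hσ, hσw⟩ := hD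
  obtain ⟨α, r, hα⟩ := exists_attr_strategy G X p D
  have hDA : D ⊆ G.attr X p D := subset_attr hDX
  refine ⟨attr_subset _ _ _, ?_, fun v => if v ∈ D then σ v else α v, ?_, ?_⟩
  · intro v hv ho w hw hm
    by_cases hvD : v ∈ D
    · exact hDA (hDc v hvD ho w hw hm)
    · exact ((hα v hv hvD).2 ho w hw hm).1
  · intro v hv ho
    by_cases hvD : v ∈ D
    · simp only [hvD, if_true]
      exact ⟨(hσ v hvD ho).1, hDA (hσ v hvD ho).2⟩
    · simp only [hvD, if_false]
      have := (hα v hv hvD).1 ho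
      exact ⟨this.1, this.2.1⟩
  · intro π hπ
    beta_reduce at hπ
    have hstep : ∀ i, π i ∈ G.attr X p D → π i ∉ D →
        π (i + 1) ∈ G.attr X p D ∧ r (π (i + 1)) < r (π i) := by
      intro i hi hiD
      by_cases ho : G.owner (π i) = p
      · rw [(hπ i).2.2 ho, if_neg hiD]
        exact ((hα _ hi hiD).1 ho).2
      · exact (hα _ hi hiD).2 ho _ (attr_subset _ _ _ (hπ (i + 1)).1) (hπ i).2.1
    obtain ⟨n, -, hn⟩ := exists_visit hstep (hπ 0).1
    have hin : ∀ i, π (i + n) ∈ D := by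
      intro i
      induction i with
      | zero => simpa using hn
      | succ i ih =>
        obtain ⟨-, hm, ho⟩ := hπ (i + n)
        rw [show i + 1 + n = i + n + 1 by omega]
        by_cases hp : G.owner (π (i + n)) = p
        · rw [ho hp, if_pos ih]
          exact (hσ _ ih hp).2
        · exact hDc _ ih hp _ (attr_subset _ _ _ (hπ (i + n + 1)).1) hm
    refine Wins.of_tail n (hσw _ fun i => ⟨hin i, ?_, ?_⟩)
    · rw [show i + 1 + n = i + n + 1 by omega]; exact (hπ (i + n)).2.1
    · intro ho
      rw [show i + 1 + n = i + n + 1 by omega, (hπ (i + n)).2.2 ho, if_pos (hin i)]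

/-! ### Winning regions. -/

theorem eq_not_of_ne {q p : Player} (h : q ≠ p) : q = !p := by
  revert h; cases q <;> cases p <;> simp

theorem not_ne_self (p : Player) : (!p) ≠ p := by cases p <;> simp

/-- `W` gives the winning regions of the subgame `X`. -/
structure Solves (G : ParityGame V) (X : Finset V) (W : Player → Finset V) : Prop where
  dom : ∀ p, G.IsDominion X p (W p)
  cover : ∀ v ∈ X, ∀ p, v ∈ W p ∨ v ∈ W (!p)

theorem Solves.subset {X : Finset V} {W : Player → Finset V} (h : G.Solves X W) (p : Player) :
    W p ⊆ X := (h.dom p).1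

theorem Solves.dominion_subset {X D : Finset V} {W : Player → Finset V} (h : G.Solves X W)
    {p : Player} (hD : G.IsDominion X p D) : D ⊆ W p := fun v hv =>
  (h.cover v (hD.1 hv) p).resolve_right fun h' => hD.disjoint (h.dom _) hv h'

theorem Solves.sdiff {X : Finset V} {W : Player → Finset V} (h : G.Solves X W) (p : Player) :
    X \ W (!p) = W p := by
  ext v
  rw [Finset.mem_sdiff]
  exact ⟨fun hv => (h.cover v hv.1 p).resolve_right hv.2,
    fun hv => ⟨h.subset p hv, fun h' => (h.dom p).disjoint (h.dom _) hv h'⟩⟩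

/-- Winning regions contain all dominions, so complementary dominions determine them. This
identifies the regions returned by an arbitrary run. -/
theorem Solves.eq_of_partition {X D : Finset V} {W : Player → Finset V} (h : G.Solves X W)
    {p : Player} (hD : G.IsDominion X p D) (hE : G.IsDominion X (!p) (X \ D)) : W p = D := by
  refine subset_antisymm (fun v hv => ?_) (h.dominion_subset hD)
  by_contra hvD
  have : v ∈ W (!p) := h.dominion_subset hE (Finset.mem_sdiff.2 ⟨h.subset p hv, hvD⟩)
  exact (h.dom p).disjoint (h.dom _) hv this

theorem regions_self (p : Player) (A B : Finset V) : regions p A B p = A := by simp [regions]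

theorem regions_not (p : Player) (A B : Finset V) : regions p A B (!p) = B := by simp [regions]

theorem solves_of_dominions {X A B : Finset V} {p : Player} (hA : G.IsDominion X p A)
    (hB : G.IsDominion X (!p) B) (h : ∀ v ∈ X, v ∈ A ∨ v ∈ B) : G.Solves X (regions p A B) := by
  refine ⟨fun q => ?_, fun v hv q => ?_⟩
  · by_cases hq : q = p
    · subst hq; rwa [regions_self]
    · rw [eq_not_of_ne hq, regions_not]; exact hB
  · by_cases hq : q = p
    · subst hq; rw [regions_self, regions_not]; exact h v hv
    · rw [eq_not_of_ne hq, Bool.not_not, regions_self, regions_not]; exact (h v hv).symm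

/-- The complement of a `p`-attractor is closed under the moves of `p`. -/
theorem mem_sdiff_attr {X U : Finset V} {p : Player} {v w : V} (hv : v ∈ X \ G.attr X p U)
    (ho : G.owner v ≠ !p) (hw : w ∈ X) (hm : G.move v w) : w ∈ X \ G.attr X p U := by
  have ho' : G.owner v = p := by simpa using eq_not_of_ne ho
  rw [Finset.mem_sdiff] at hv ⊢
  exact ⟨hw, fun h => hv.2 (mem_attr_of_own hv.1 ho' hm h)⟩

theorem Solves.dominion_not {X U : Finset V} {p : Player} {W : Player → Finset V}
    (h : G.Solves (X \ G.attr X p U) W) : G.IsDominion X (!p) (W (!p)) :=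
  (h.dom (!p)).mono Finset.sdiff_subset fun _ hv ho _ hw hm =>
    mem_sdiff_attr (h.subset _ hv) ho hw hm

theorem Solves.dominion_union {X U : Finset V} {p : Player} {W : Player → Finset V}
    (h : G.Solves (X \ G.attr X p U) W) (hU : G.IsDominion X p U) :
    G.IsDominion X p (X \ W (!p)) := by
  have : X \ W (!p) = G.attr X p U ∪ W p := by
    rw [← h.sdiff p]
    ext v
    have := attr_subset (G := G) X U p
    have h2 := h.subset (!p)
    simp only [Finset.mem_sdiff, Finset.mem_union]
    constructor
    · tauto
    · rintro (h1 | h1)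
      · exact ⟨this h1, fun h3 => (Finset.mem_sdiff.1 (h2 h3)).2 h1⟩
      · exact ⟨h1.1.1, h1.2⟩
  rw [this]
  refine hU.attr.union (h.dom p) Finset.sdiff_subset fun v _ _ w hw _ => ?_
  by_cases hA : w ∈ G.attr X p U
  · exact .inr hA
  · exact .inl (Finset.mem_sdiff.2 ⟨hw, hA⟩)

theorem priority_le_maxPriority {X : Finset V} {v : V} (h : v ∈ X) :
    G.priority v ≤ G.maxPriority X := Finset.le_sup h

theorem maxPositions_subset (X : Finset V) : G.maxPositions X ⊆ X := Finset.filter_subset _ _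

/-- A play either returns to the attractor infinitely often, and so sees the maximal priority
infinitely often, or finally stays in the left subgame, where the leader's strategy wins. The
hypothesis `hpre` keeps the opponent from entering its region and gives the leader a move that
avoids it. -/
theorem leader_dominion {X : Finset V} {W : Player → Finset V} (h : G.Solves (G.leftGame X) W)
    (hpre : G.pre X (!G.leader X) (W (!G.leader X)) \ W (!G.leader X) = ∅) :
    G.IsDominion X (G.leader X) (X \ W (!G.leader X)) := by
  classical
  set p := G.leader X with hp
  set U := G.maxPositions X with hU
  obtain ⟨α, r, hα⟩ := exists_attr_strategy G X p U
  obtain ⟨-, hEc, σ, hσ, hσw⟩ := h.dom p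
  have hdis : ∀ v, v ∈ W p → v ∉ W (!p) := fun v h1 h2 => (h.dom p).disjoint (h.dom _) h1 h2
  have hAW : ∀ v, v ∈ G.attr X p U → v ∉ W (!p) := fun v h1 h2 =>
    (Finset.mem_sdiff.1 (h.subset _ h2)).2 h1
  have hE : ∀ v ∈ X \ W (!p), v ∉ G.attr X p U → v ∈ W p := fun v hv hA =>
    (h.cover v (Finset.mem_sdiff.2 ⟨(Finset.mem_sdiff.1 hv).1, hA⟩) p).resolve_right
      (Finset.mem_sdiff.1 hv).2
  have hpre' : ∀ v ∈ X \ W (!p), v ∉ G.pre X (!p) (W (!p)) := by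
    intro v hv hvp
    have : v ∈ G.pre X (!p) (W (!p)) \ W (!p) :=
      Finset.mem_sdiff.2 ⟨hvp, (Finset.mem_sdiff.1 hv).2⟩
    rw [hpre] at this
    simp at this
  have hex : ∀ v ∈ X \ W (!p), G.owner v = p → ∃ w, G.move v w ∧ w ∈ X \ W (!p) := by
    intro v hv ho
    by_contra hcon
    push Not at hcon
    refine hpre' v hv (Finset.mem_filter.2 ⟨(Finset.mem_sdiff.1 hv).1, .inr ⟨?_, ?_⟩⟩)
    · rw [ho]; exact (not_ne_self p).symm
    · intro w hw hm
      by_contra hwW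
      exact hcon w hm (Finset.mem_sdiff.2 ⟨hw, hwW⟩)
  choose! β hβ using hex
  let s : V → V := fun v => if v ∈ G.attr X p U then (if v ∈ U then β v else α v) else σ v
  refine ⟨Finset.sdiff_subset, ?_, s, ?_, ?_⟩
  · intro v hv ho w hw hm
    refine Finset.mem_sdiff.2 ⟨hw, fun hwW => hpre' v hv ?_⟩
    exact Finset.mem_filter.2 ⟨(Finset.mem_sdiff.1 hv).1, .inl ⟨eq_not_of_ne ho, w, hw, hm, hwW⟩⟩
  · intro v hv ho
    by_cases hA : v ∈ G.attr X p U
    · by_cases hvU : v ∈ U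
      · simp only [s, hA, hvU, if_true]; exact hβ v hv ho
      · simp only [s, hA, hvU, if_true, if_false]
        have := (hα v hA hvU).1 ho
        exact ⟨this.1, Finset.mem_sdiff.2 ⟨attr_subset _ _ _ this.2.1, hAW _ this.2.1⟩⟩
    · simp only [s, hA, if_false]
      have := hσ v (hE v hv hA) ho
      exact ⟨this.1, Finset.mem_sdiff.2
        ⟨(Finset.mem_sdiff.1 (h.subset _ this.2)).1, hdis _ this.2⟩⟩
  · intro π hπ
    have hX : ∀ i, π i ∈ X := fun i => (Finset.mem_sdiff.1 (hπ i).1).1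
    by_cases hinf : ∃ᶠ i in atTop, π i ∈ G.attr X p U
    · refine ⟨G.maxPriority X, rfl, ?_, Eventually.of_forall fun i =>
        priority_le_maxPriority (hX i)⟩
      rw [frequently_atTop] at hinf ⊢
      intro n
      obtain ⟨i, hi, hiA⟩ := hinf n
      have hstep : ∀ i, π i ∈ G.attr X p U → π i ∉ U →
          π (i + 1) ∈ G.attr X p U ∧ r (π (i + 1)) < r (π i) := by
        intro i hi hiD
        by_cases ho : G.owner (π i) = p
        · rw [(hπ i).2.2 ho]
          simp only [s, hi, hiD, if_true, if_false]
          exact ((hα _ hi hiD).1 ho).2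
        · exact (hα _ hi hiD).2 ho _ (hX (i + 1)) (hπ i).2.1
      obtain ⟨j, hj, hjU⟩ := exists_visit hstep hiA
      exact ⟨j, by omega, (Finset.mem_filter.1 hjU).2⟩
    · rw [not_frequently, eventually_atTop] at hinf
      obtain ⟨n, hn⟩ := hinf
      refine Wins.of_tail n (hσw _ fun i => ⟨hE _ (hπ _).1 (hn _ (by omega)), ?_, ?_⟩)
      · rw [show i + 1 + n = i + n + 1 by omega]; exact (hπ (i + n)).2.1
      · intro ho
        rw [show i + 1 + n = i + n + 1 by omega, (hπ (i + n)).2.2 ho]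
        simp only [s, hn (i + n) (by omega), if_false]

/-! ### Correctness and termination of the algorithm. -/

theorem IsBottomSCC.closed {X C : Finset V} (h : G.IsBottomSCC X C) {v w : V} (hv : v ∈ C)
    (hw : w ∈ X) (hm : G.move v w) : w ∈ C :=
  (h.2.2 v hv w).2 (.single ⟨h.2.1 hv, hw, hm⟩)

/-- Every record of the memoization table is correct. -/
def Memo.Correct (G : ParityGame V) (M : Memo V) : Prop := ∀ X W, M X = some W → G.Solves X W

theorem Memo.Correct.store {M : Memo V} (h : Memo.Correct G M) {X : Finset V}
    {W : Player → Finset V} (hW : G.Solves X W) : Memo.Correct G (M.store X W) := by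
  intro Y W' hY
  unfold Memo.store at hY
  by_cases hYX : Y = X
  · subst hYX
    rw [Function.update_self] at hY
    cases hY; exact hW
  · rw [Function.update_of_ne hYX] at hY
    exact h Y W' hY

/-- No move leaves a bottom component, so its dominions are dominions of `X`. From the rest, the
opponent of `p` cannot enter its own attractor, hence can escape only into that of `p`. -/
theorem Solves.scc {X C : Finset V} {W₁ W₂ : Player → Finset V} (hC : G.IsBottomSCC X C)
    (h₁ : G.Solves C W₁)
    (h₂ : G.Solves (X \ (G.attr X false (W₁ false) ∪ G.attr X true (W₁ true))) W₂) :
    G.Solves X fun p => G.attr X p (W₁ p) ∪ W₂ p := by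
  have hA : ∀ p, X \ (G.attr X false (W₁ false) ∪ G.attr X true (W₁ true)) =
      X \ (G.attr X p (W₁ p) ∪ G.attr X (!p) (W₁ (!p))) := by
    intro p; cases p
    · rfl
    · rw [Bool.not_true, Finset.union_comm]
  have hD : ∀ p, G.IsDominion X p (W₁ p) := fun p =>
    (h₁.dom p).mono hC.2.1 fun v hv _ w hw hm => hC.closed (h₁.subset p hv) hw hm
  refine ⟨fun p => ?_, fun v hv p => ?_⟩
  · refine (hD p).attr.union (h₂.dom p) Finset.sdiff_subset fun v hv ho w hw hm => ?_
    have hv' := h₂.subset p hv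
    rw [hA p, Finset.mem_sdiff, Finset.mem_union] at hv' ⊢
    by_cases h3 : w ∈ G.attr X p (W₁ p)
    · exact .inr h3
    · refine .inl ⟨hw, fun h4 => ?_⟩
      have h4 := h4.resolve_left h3
      exact hv'.2 (.inr (mem_attr_of_own hv'.1 (eq_not_of_ne ho) hm h4))
  · simp only [Finset.mem_union]
    by_cases h3 : v ∈ G.attr X p (W₁ p)
    · exact .inl (.inl h3)
    by_cases h4 : v ∈ G.attr X (!p) (W₁ (!p))
    · exact .inr (.inl h4)
    have : v ∈ X \ (G.attr X false (W₁ false) ∪ G.attr X true (W₁ true)) := by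
      rw [hA p, Finset.mem_sdiff, Finset.mem_union]; tauto
    have := h₂.cover v this p
    tauto

theorem Solves.of_dominion {X D : Finset V} {p : Player} {W : Player → Finset V}
    (hD : G.IsDominion X p D) (h : G.Solves (X \ G.attr X p D) W) :
    G.Solves X (regions p (X \ W (!p)) (W (!p))) :=
  solves_of_dominions (h.dominion_union hD) h.dominion_not fun v hv => by
    rw [Finset.mem_sdiff]; tauto

theorem Solves.of_left {X : Finset V} {W : Player → Finset V} (h : G.Solves (G.leftGame X) W)
    (hpre : G.pre X (!G.leader X) (W (!G.leader X)) \ W (!G.leader X) = ∅) :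
    G.Solves X (regions (G.leader X) (X \ W (!G.leader X)) (W (!G.leader X))) :=
  solves_of_dominions (leader_dominion h hpre) h.dominion_not fun v hv => by
    rw [Finset.mem_sdiff]; tauto

theorem Solves.of_right {X : Finset V} {W₁ W₂ : Player → Finset V}
    (h₁ : G.Solves (G.leftGame X) W₁) (h₂ : G.Solves (G.rightGame X (W₁ (!G.leader X))) W₂) :
    G.Solves X (regions (G.leader X) (W₂ (G.leader X)) (X \ W₂ (G.leader X))) := by
  have := Solves.dominion_union h₂ (Solves.dominion_not h₁)
  have h' := Solves.dominion_not h₂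
  rw [Bool.not_not] at this h'
  exact solves_of_dominions h' this fun v hv => by rw [Finset.mem_sdiff]; tauto

theorem solves_empty : G.Solves ∅ fun _ => ∅ :=
  ⟨fun p => isDominion_empty _ p, by simp⟩

theorem Exec.correct {ℓ : ℕ → ℕ} {M M' : Memo V} {X : Finset V} {W : Player → Finset V} {t : ℕ}
    (h : G.Exec ℓ M X W M' t) (hM : Memo.Correct G M) :
    Memo.Correct G M' ∧ G.Solves X W := by
  induction h with
  | hit M X W h => exact ⟨hM, hM X W h⟩
  | empty M h => exact ⟨hM, solves_empty⟩
  | scc M M₁ M₂ X C W₁ W₂ t₁ t₂ _ _ hC _ _ _ ih₁ ih₂ =>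
    obtain ⟨hM₁, h₁⟩ := ih₁ hM
    obtain ⟨hM₂, h₂⟩ := ih₂ hM₁
    exact ⟨hM₂.store (.scc hC h₁ h₂), .scc hC h₁ h₂⟩
  | dominion M M₁ X D L₁ L₂ p W₁ t₁ _ _ _ _ _ hD _ ih =>
    obtain ⟨hM₁, h₁⟩ := ih hM
    exact ⟨hM₁.store (.of_dominion hD h₁), .of_dominion hD h₁⟩
  | left M M₁ X L W₁ t₁ _ _ _ _ _ _ hpre ih =>
    obtain ⟨hM₁, h₁⟩ := ih hM
    exact ⟨hM₁.store (.of_left h₁ hpre), .of_left h₁ hpre⟩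
  | right M M₁ M₂ X L W₁ W₂ t₁ t₂ _ _ _ _ _ _ _ _ ih₁ ih₂ =>
    obtain ⟨hM₁, h₁⟩ := ih₁ hM
    obtain ⟨hM₂, h₂⟩ := ih₂ hM₁
    exact ⟨hM₂.store (.of_right h₁ h₂), .of_right h₁ h₂⟩

theorem exists_bottomSCC (G : ParityGame V) {X : Finset V} (hX : X.Nonempty) :
    ∃ C, G.IsBottomSCC X C := by
  classical
  let S : V → V → Prop := Relation.ReflTransGen fun a b => a ∈ X ∧ b ∈ X ∧ G.move a b
  let R : V → Finset V := fun v => X.filter (S v)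
  have hmem : ∀ v ∈ X, ∀ w, w ∈ R v ↔ S v w := by
    intro v hv w
    simp only [R, Finset.mem_filter, and_iff_right_iff_imp]
    intro h
    rcases Relation.ReflTransGen.cases_tail h with h | ⟨u, -, h⟩
    · exact h ▸ hv
    · exact h.2.1
  -- A position with the fewest reachable positions lies in a bottom component.
  obtain ⟨v, hv, hmin⟩ := X.exists_min_image (fun v => (R v).card) hX
  refine ⟨R v, ⟨v, (hmem v hv v).2 .refl⟩, Finset.filter_subset _ _, fun u hu w => ?_⟩
  have huX : u ∈ X := Finset.filter_subset _ _ hu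
  have hsub : R u ⊆ R v := fun x hx =>
    (hmem v hv x).2 (((hmem v hv u).1 hu).trans ((hmem u huX x).1 hx))
  rw [← Finset.eq_of_subset_of_card_le hsub (hmin u huX)]
  exact hmem u huX w

theorem exists_searchOrder (X : Finset V) (l : ℕ) : ∃ L, IsSearchOrder X l L := by
  classical
  let F := X.powerset.filter fun S => S.Nonempty ∧ S.card ≤ l
  let r : Finset V → Finset V → Prop := fun S T => S.card ≤ T.card
  have : Std.Total r := ⟨fun S T => le_total _ _⟩
  have : IsTrans _ r := ⟨fun S T U => le_trans⟩
  refine ⟨F.toList.insertionSort r, ?_, fun S => ?_, List.pairwise_insertionSort r _⟩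
  · exact (List.perm_insertionSort r _).nodup_iff.2 F.nodup_toList
  · simp [F]

theorem exists_first {α : Type} (P : α → Prop) (L : List α) (h : ∃ S ∈ L, P S) :
    ∃ L₁ D L₂, L = L₁ ++ D :: L₂ ∧ (∀ S ∈ L₁, ¬ P S) ∧ P D := by
  induction L with
  | nil => simp at h
  | cons a L ih =>
    by_cases ha : P a
    · exact ⟨[], a, L, rfl, by simp, ha⟩
    · obtain ⟨S, hS, hP⟩ := h
      have hSL : S ∈ L := by
        rcases List.mem_cons.1 hS with rfl | h
        · exact absurd hP ha
        · exact h
      obtain ⟨L₁, D, L₂, h1, h2, h3⟩ := ih ⟨S, hSL, hP⟩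
      refine ⟨a :: L₁, D, L₂, by rw [h1]; rfl, fun T hT => ?_, h3⟩
      rcases List.mem_cons.1 hT with rfl | h
      · exact ha
      · exact h2 T h

theorem card_sdiff_lt {X A : Finset V} {v : V} (hv : v ∈ X) (hA : v ∈ A) :
    (X \ A).card < X.card := by
  refine Finset.card_lt_card ⟨Finset.sdiff_subset, fun h => ?_⟩
  exact (Finset.mem_sdiff.1 (h hv)).2 hA

theorem exists_mem_maxPositions (G : ParityGame V) {X : Finset V} (hX : X.Nonempty) :
    ∃ v, v ∈ G.maxPositions X := by
  obtain ⟨v, hv, h⟩ := X.exists_mem_eq_sup hX G.priority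
  exact ⟨v, Finset.mem_filter.2 ⟨hv, h.symm⟩⟩

/-- The algorithm terminates. -/
theorem exists_exec (G : ParityGame V) (ℓ : ℕ → ℕ) (M : Memo V) (X : Finset V)
    (hM : Memo.Correct G M) : ∃ W M' t, G.Exec ℓ M X W M' t := by
  classical
  induction hn : X.card using Nat.strong_induction_on generalizing X M with
  | _ n ih =>
    subst hn
    rcases hMX : M X with _ | W
    swap
    · exact ⟨_, _, _, .hit M X W hMX⟩
    rcases X.eq_empty_or_nonempty with rfl | hX
    · exact ⟨_, _, _, .empty M hMX⟩
    by_cases hscc : G.IsBottomSCC X X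
    · obtain ⟨L, hL⟩ := exists_searchOrder X (ℓ X.card)
      by_cases hex : ∃ S ∈ L, ∃ p, G.IsDominion X p S
      · obtain ⟨L₁, D, L₂, rfl, hL₁, p, hD⟩ := exists_first _ L hex
        have hDX := (hL.2.1 D).1 (by simp)
        obtain ⟨v, hv⟩ := hDX.2.1
        have hlt : (X \ G.attr X p D).card < X.card :=
          card_sdiff_lt (hDX.1 hv) (subset_attr hDX.1 hv)
        obtain ⟨W, M', t, h⟩ := ih _ hlt M _ hM rfl
        exact ⟨_, _, _, .dominion M M' X D L₁ L₂ p W t hMX hX hscc hL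
          (fun S hS q hq => hL₁ S hS ⟨q, hq⟩) hD h⟩
      · push Not at hex
        obtain ⟨v, hv⟩ := exists_mem_maxPositions G hX
        have hlt : (G.leftGame X).card < X.card :=
          card_sdiff_lt (maxPositions_subset X hv) (subset_attr (maxPositions_subset X) hv)
        obtain ⟨W₁, M₁, t₁, h₁⟩ := ih _ hlt M _ hM rfl
        by_cases hpre : G.pre X (!G.leader X) (W₁ (!G.leader X)) \ W₁ (!G.leader X) = ∅
        · exact ⟨_, _, _, .left M M₁ X L W₁ t₁ hMX hX hscc hL hex h₁ hpre⟩
        · obtain ⟨hM₁, hW₁⟩ := h₁.correct hM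
          obtain ⟨w, hw⟩ := Finset.nonempty_iff_ne_empty.2 hpre
          have hw := (Finset.mem_sdiff.1 hw).1
          unfold pre at hw
          rw [Finset.mem_filter] at hw
          have hsub : W₁ (!G.leader X) ⊆ X := (hW₁.subset _).trans Finset.sdiff_subset
          -- The new position `w` also lies in the attractor, so the right subgame is strictly
          -- smaller.
          have hwA : w ∈ G.attr X (!G.leader X) (W₁ (!G.leader X)) := by
            rcases hw.2 with ⟨ho, u, hu, hm, huW⟩ | ⟨ho, h⟩
            · exact mem_attr_of_own hw.1 ho hm (subset_attr hsub huW)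
            · exact mem_attr_of_opp hw.1 ho fun u hu hm => subset_attr hsub (h u hu hm)
          have hlt₂ : (G.rightGame X (W₁ (!G.leader X))).card < X.card :=
            card_sdiff_lt hw.1 hwA
          obtain ⟨W₂, M₂, t₂, h₂⟩ := ih _ hlt₂ M₁ _ hM₁ rfl
          exact ⟨_, _, _, .right M M₁ M₂ X L W₁ W₂ t₁ t₂ hMX hX hscc hL hex h₁ hpre h₂⟩
    · obtain ⟨C, hC⟩ := exists_bottomSCC G hX
      have hne : C ≠ X := fun h => hscc (by rwa [h] at hC)
      obtain ⟨W₁, M₁, t₁, h₁⟩ :=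
        ih _ (Finset.card_lt_card (hC.2.1.ssubset_of_ne hne)) M _ hM rfl
      obtain ⟨hM₁, hW₁⟩ := h₁.correct hM
      obtain ⟨v, hv⟩ := hC.1
      have hsub : ∀ p, W₁ p ⊆ X := fun p => (hW₁.subset p).trans hC.2.1
      have hvA : v ∈ G.attr X false (W₁ false) ∪ G.attr X true (W₁ true) := by
        rw [Finset.mem_union]
        exact (hW₁.cover v hv false).imp (fun h => subset_attr (hsub _) h)
          fun h => subset_attr (hsub _) h
      obtain ⟨W₂, M₂, t₂, h₂⟩ := ih _ (card_sdiff_lt (hC.2.1 hv) hvA) M₁ _ hM₁ rfl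
      exact ⟨_, _, _, .scc M M₁ M₂ X C W₁ W₂ t₁ t₂ hMX hX hC hne h₁ h₂⟩

/-! ### Records of the memoization table and forced calls. -/

theorem Memo.correct_empty : Memo.Correct G Memo.empty := fun X W h => by
  simp [Memo.empty] at h

theorem Memo.store_self (M : Memo V) (X : Finset V) (W : Player → Finset V) :
    M.store X W X ≠ none := by
  simp [Memo.store]

theorem Memo.store_ne_none {M : Memo V} {X Y : Finset V} {W : Player → Finset V}
    (h : M Y ≠ none) : M.store X W Y ≠ none := by
  by_cases hY : Y = X
  · subst hY; exact store_self _ _ _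
  · rwa [Memo.store, Function.update_of_ne hY]

theorem Memo.eq_or_of_store {M : Memo V} {X Y : Finset V} {W : Player → Finset V}
    (h : M.store X W Y ≠ none) : Y = X ∨ M Y ≠ none := by
  by_cases hY : Y = X
  · exact .inl hY
  · rw [Memo.store, Function.update_of_ne hY] at h
    exact .inr h

theorem Exec.recorded_mono {ℓ : ℕ → ℕ} {M M' : Memo V} {X : Finset V} {W : Player → Finset V}
    {t : ℕ} (h : G.Exec ℓ M X W M' t) {Y : Finset V} (hY : M Y ≠ none) : M' Y ≠ none := by
  induction h with
  | hit => exact hY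
  | empty => exact hY
  | scc M M₁ M₂ X C W₁ W₂ t₁ t₂ _ _ hC _ _ _ ih₁ ih₂ => exact Memo.store_ne_none (ih₂ (ih₁ hY))
  | dominion M M₁ X D L₁ L₂ p W₁ t₁ _ _ _ _ _ hD _ ih => exact Memo.store_ne_none (ih hY)
  | left M M₁ X L W₁ t₁ _ _ _ _ _ _ hpre ih => exact Memo.store_ne_none (ih hY)
  | right M M₁ M₂ X L W₁ W₂ t₁ t₂ _ _ _ _ _ _ _ _ ih₁ ih₂ =>
    exact Memo.store_ne_none (ih₂ (ih₁ hY))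

theorem Exec.recorded {ℓ : ℕ → ℕ} {M M' : Memo V} {X : Finset V} {W : Player → Finset V}
    {t : ℕ} (h : G.Exec ℓ M X W M' t) (hX : X.Nonempty) : M' X ≠ none := by
  cases h with
  | hit h => rw [‹M X = some W›]; simp
  | empty => simp at hX
  | scc => exact Memo.store_self _ _ _
  | dominion => exact Memo.store_self _ _ _
  | left => exact Memo.store_self _ _ _
  | right => exact Memo.store_self _ _ _

open Classical in
/-- The subgames recorded in the table. -/
noncomputable def Memo.records [Fintype V] (M : Memo V) : Finset (Finset V) :=
  Finset.univ.filter fun X => M X ≠ none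

theorem Memo.card_records_store [Fintype V] (M : Memo V) (X : Finset V)
    (W : Player → Finset V) : (M.store X W).records.card ≤ M.records.card + 1 := by
  refine (Finset.card_le_card (t := insert X M.records) fun Y hY => ?_).trans
    (Finset.card_insert_le _ _)
  simp only [Memo.records, Finset.mem_filter, Finset.mem_univ, true_and,
    Finset.mem_insert] at hY ⊢
  exact Memo.eq_or_of_store hY

/-- Each call stores at most one new record, paid for by the step charged for the call itself. -/
theorem Exec.card_records [Fintype V] {ℓ : ℕ → ℕ} {M M' : Memo V} {X : Finset V}
    {W : Player → Finset V} {t : ℕ} (h : G.Exec ℓ M X W M' t) :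
    M'.records.card ≤ M.records.card + t := by
  induction h with
  | hit => omega
  | empty => omega
  | scc M M₁ M₂ X C W₁ W₂ t₁ t₂ _ _ hC _ _ _ ih₁ ih₂ =>
    refine (Memo.card_records_store _ _ _).trans ?_
    omega
  | dominion M M₁ X D L₁ L₂ p W₁ t₁ _ _ _ _ _ hD _ ih =>
    refine (Memo.card_records_store _ _ _).trans ?_
    omega
  | left M M₁ X L W₁ t₁ _ _ _ _ _ _ hpre ih =>
    refine (Memo.card_records_store _ _ _).trans ?_
    omega
  | right M M₁ M₂ X L W₁ W₂ t₁ t₂ _ _ _ _ _ _ _ _ ih₁ ih₂ =>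
    refine (Memo.card_records_store _ _ _).trans ?_
    omega

/-- `Y` is a nonempty subgame that every call on the strongly connected subgame `X` solves, unless
it finds a dominion, for which it needs more than `b` tests. -/
structure ForcedCall (G : ParityGame V) (b : ℕ) (X Y : Finset V) : Prop where
  scc : G.IsBottomSCC X X
  nonempty : Y.Nonempty
  search : ∀ l L₁ D L₂ p, IsSearchOrder X l (L₁ ++ D :: L₂) → G.IsDominion X p D →
    b ≤ L₁.length + 1
  call : ∀ W, G.Solves (G.leftGame X) W → Y = G.leftGame X ∨
    G.pre X (!G.leader X) (W (!G.leader X)) \ W (!G.leader X) ≠ ∅ ∧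
      Y = G.rightGame X (W (!G.leader X))

/-- With each recorded subgame, its forced calls are recorded. -/
def Memo.Closed (G : ParityGame V) (b : ℕ) (M : Memo V) : Prop :=
  ∀ X Y, G.ForcedCall b X Y → M X ≠ none → M Y ≠ none

theorem Memo.Closed.store {b : ℕ} {M : Memo V} (h : Memo.Closed G b M) {X : Finset V}
    {W : Player → Finset V} (hX : ∀ Y, G.ForcedCall b X Y → M Y ≠ none) :
    Memo.Closed G b (M.store X W) := by
  intro Z Y hZY hZ
  apply Memo.store_ne_none
  rcases Memo.eq_or_of_store hZ with rfl | hZ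
  · exact hX Y hZY
  · exact h Z Y hZY hZ

theorem bottomSCC_unique {X C D : Finset V} (hC : G.IsBottomSCC X C) (hD : G.IsBottomSCC X D)
    {v : V} (h1 : v ∈ C) (h2 : v ∈ D) : C = D := by
  ext w
  rw [hC.2.2 v h1 w, hD.2.2 v h2 w]

/-- A game with forced calls is strongly connected, so it is not decomposed, and with fewer than `b`
steps no search in it succeeds. It is thus recorded only after its left call and, where needed, its
right call. Correctness fixes the region on which the right call depends. -/
theorem Exec.closed {ℓ : ℕ → ℕ} {M M' : Memo V} {X : Finset V} {W : Player → Finset V} {t b : ℕ}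
    (h : G.Exec ℓ M X W M' t) (hc : Memo.Correct G M) (hM : Memo.Closed G b M) (ht : t < b) :
    Memo.Closed G b M' := by
  induction h with
  | hit => exact hM
  | empty => exact hM
  | scc M M₁ M₂ X C W₁ W₂ t₁ t₂ _ _ hC hne e₁ e₂ ih₁ ih₂ =>
    refine (ih₂ (e₁.correct hc).1 (ih₁ hc hM (by omega)) (by omega)).store fun Y hY => ?_
    obtain ⟨v, hv⟩ := hC.1
    exact absurd (bottomSCC_unique hC hY.scc hv (hC.2.1 hv)) hne
  | dominion M M₁ X D L₁ L₂ p W₁ t₁ _ _ _ hL _ hD e ih =>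
    refine (ih hc hM (by omega)).store fun Y hY => ?_
    have := hY.search _ _ _ _ _ hL hD
    omega
  | left M M₁ X L W₁ t₁ _ _ _ _ _ e hpre ih =>
    refine (ih hc hM (by omega)).store fun Y hY => ?_
    rcases hY.call W₁ (e.correct hc).2 with rfl | ⟨h, -⟩
    · exact e.recorded hY.nonempty
    · exact absurd hpre h
  | right M M₁ M₂ X L W₁ W₂ t₁ t₂ _ _ _ _ _ e₁ _ e₂ ih₁ ih₂ =>
    refine (ih₂ (e₁.correct hc).1 (ih₁ hc hM (by omega)) (by omega)).store fun Y hY => ?_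
    rcases hY.call W₁ (e₁.correct hc).2 with rfl | ⟨-, rfl⟩
    · exact e₂.recorded_mono (e₁.recorded hY.nonempty)
    · exact e₂.recorded hY.nonempty

end General

/-! ### Recurring priorities and the cost of a search. -/

theorem exists_recurring_max (a : ℕ → ℕ) (B : ℕ) (h : ∀ i, a i ≤ B) :
    ∃ m, (∃ᶠ i in atTop, a i = m) ∧ ∀ᶠ i in atTop, a i ≤ m := by
  classical
  have hex : ∃ m, ∀ᶠ i in atTop, a i ≤ m := ⟨B, Eventually.of_forall h⟩
  refine ⟨Nat.find hex, fun hne => ?_, Nat.find_spec hex⟩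
  have hlt : ∀ᶠ i in atTop, a i < Nat.find hex := by
    filter_upwards [hne, Nat.find_spec hex] with i h1 h2
    exact lt_of_le_of_ne h2 h1
  rcases hm : Nat.find hex with _ | m
  · obtain ⟨i, hi⟩ := hlt.exists
    omega
  · refine Nat.find_min hex (m := m) (by omega) ?_
    filter_upwards [hlt] with i hi
    omega

theorem not_frequently_decreasing {R : ℕ → ℕ} {N : ℕ} (h : ∀ i ≥ N, R (i + 1) ≤ R i)
    (h' : ∃ᶠ i in atTop, R (i + 1) < R i) : False := by
  have hmono : ∀ i ≥ N, ∀ j, R (i + j) ≤ R i := by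
    intro i hi j
    induction j with
    | zero => exact le_rfl
    | succ j ih => exact (h (i + j) (by omega)).trans ih
  have : ∀ n, ∀ i ≥ N, R i = n → False := by
    intro n
    induction n using Nat.strong_induction_on with
    | _ n ih =>
      intro i hi hn
      obtain ⟨j, hj, hlt⟩ := (frequently_atTop.1 h') i
      have := hmono i hi (j - i)
      rw [show i + (j - i) = j by omega] at this
      exact ih (R (j + 1)) (by omega) (j + 1) (by omega) rfl
  exact this _ N le_rfl rfl

/-- In a search that finds a dominion `D`, all nonempty proper subsets of `D` are tested before. -/
theorem IsSearchOrder.two_pow_le {V : Type} [DecidableEq V] {X D : Finset V} {l : ℕ}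
    {L₁ L₂ : List (Finset V)} (h : IsSearchOrder X l (L₁ ++ D :: L₂)) :
    2 ^ D.card ≤ L₁.length + 2 := by
  obtain ⟨-, hmem, hsort⟩ := h
  have hD := (hmem D).1 (by simp)
  have hsub : (D.powerset.erase D).erase ∅ ⊆ L₁.toFinset := by
    intro S hS
    rw [Finset.mem_erase, Finset.mem_erase, Finset.mem_powerset] at hS
    have hlt := Finset.card_lt_card (hS.2.2.ssubset_of_ne hS.2.1)
    have : S ∈ L₁ ++ D :: L₂ := (hmem S).2 ⟨hS.2.2.trans hD.1,
      Finset.nonempty_iff_ne_empty.2 hS.1, by omega⟩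
    rw [List.mem_append, List.mem_cons] at this
    rw [List.mem_toFinset]
    rcases this with h | rfl | h
    · exact h
    · exact absurd rfl hS.2.1
    · have := (List.pairwise_cons.1 (List.pairwise_append.1 hsort).2.1).1 S h
      omega
  have h1 := Finset.card_le_card hsub
  have h2 : L₁.toFinset.card ≤ L₁.length := L₁.toFinset_card_le
  have h3 := Finset.card_powerset D
  have h4 := Finset.pred_card_le_card_erase (s := D.powerset) (a := D)
  have h5 := Finset.pred_card_le_card_erase (s := D.powerset.erase D) (a := ∅)
  omega

/-! ### Inflated games. -/

section Inflation

variable {V K : Type} [DecidableEq V] [Fintype V]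

/-- `G` arises from `H` by replacing each position `u` by a path `(u, 0), …, (u, k - 1)`;
the position `v` of `G` is the one that is named `f v`. -/
structure Inflates (G : ParityGame V) (H : ParityGame K) (k : ℕ) (f : V → K × ℕ) : Prop where
  owner : ∀ v, G.owner v = H.owner (f v).1
  priority : ∀ v, G.priority v = H.priority (f v).1
  move : ∀ v w, G.move v w ↔ ((f w).1 = (f v).1 ∧ (f w).2 = (f v).2 + 1) ∨
    ((f v).2 + 1 = k ∧ (f w).2 = 0 ∧ H.move (f v).1 (f w).1)
  lt : ∀ v, (f v).2 < k

/-- All positions of the paths of the elements of `Y` have a name. -/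
def Full (k : ℕ) (f : V → K × ℕ) (Y : Set K) : Prop := ∀ u ∈ Y, ∀ t < k, ∃ v, f v = (u, t)

open Classical in
/-- The subgame that consists of the paths of the elements of `Y`. -/
noncomputable def blk (f : V → K × ℕ) (Y : Set K) : Finset V :=
  Finset.univ.filter fun v => (f v).1 ∈ Y

theorem mem_blk {f : V → K × ℕ} {Y : Set K} {v : V} : v ∈ blk f Y ↔ (f v).1 ∈ Y := by
  simp [blk]

theorem blk_sdiff (f : V → K × ℕ) (Y Z : Set K) : blk f Y \ blk f Z = blk f (Y \ Z) := by
  ext v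
  simp [mem_blk]

theorem blk_subset {f : V → K × ℕ} {Y Z : Set K} (h : Y ⊆ Z) : blk f Y ⊆ blk f Z :=
  fun _ hv => mem_blk.2 (h (mem_blk.1 hv))

variable {G : ParityGame V} {H : ParityGame K} {k : ℕ} {f : V → K × ℕ} {Y : Set K} {q : Player}

/-- The part of `Y` outside `A` is a trap for `q`, and inflation preserves traps: a path can be left
only from its last position. -/
theorem attr_blk_subset (hG : G.Inflates H k f) (hY : Full k f Y) {U A : Set K} (hU : U ⊆ A)
    (hown : ∀ u ∈ Y \ A, H.owner u = q → ∀ w ∈ Y, H.move u w → w ∉ A)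
    (hopp : ∀ u ∈ Y \ A, H.owner u ≠ q → ∃ w ∈ Y \ A, H.move u w) :
    G.attr (blk f Y) q (blk f U) ⊆ blk f A := by
  intro v hv
  rw [mem_attr] at hv
  rw [mem_blk]
  induction hv with
  | base v hv hvU => exact hU (mem_blk.1 hvU)
  | own v w hv ho hw hm _ ih =>
    by_contra hA
    rw [hG.owner] at ho
    rcases (hG.move v w).1 hm with ⟨h, -⟩ | ⟨-, -, h⟩
    · exact hA (h ▸ ih)
    · exact hown _ ⟨mem_blk.1 hv, hA⟩ ho _ (mem_blk.1 hw) h ih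
  | opp v hv ho _ ih =>
    by_contra hA
    rw [hG.owner] at ho
    rw [mem_blk] at hv
    have hlt := hG.lt v
    by_cases ht : (f v).2 + 1 < k
    · obtain ⟨w, hw⟩ := hY _ hv _ ht
      have := ih w (mem_blk.2 (by rw [hw]; exact hv)) ((hG.move v w).2 (.inl (by rw [hw]; simp)))
      rw [hw] at this
      exact hA this
    · obtain ⟨x, hx, hm⟩ := hopp _ ⟨hv, hA⟩ ho
      obtain ⟨w, hw⟩ := hY x hx.1 0 (by omega)
      have := ih w (mem_blk.2 (by rw [hw]; exact hx.1))
        ((hG.move v w).2 (.inr (by rw [hw]; exact ⟨by omega, rfl, hm⟩)))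
      rw [hw] at this
      exact hx.2 this

theorem mem_attr_blk_own (hG : G.Inflates H k f) (hY : Full k f Y) {U : Finset V} {u x : K}
    (hu : u ∈ Y) (ho : H.owner u = q) (hx : x ∈ Y) (hm : H.move u x)
    (hA : ∀ v, (f v).1 = x → v ∈ G.attr (blk f Y) q U) {v : V} (hv : (f v).1 = u) :
    v ∈ G.attr (blk f Y) q U := by
  induction hn : k - (f v).2 using Nat.strong_induction_on generalizing v with
  | _ n ih =>
    have hlt := hG.lt v
    have hvY : v ∈ blk f Y := mem_blk.2 (hv ▸ hu)
    have hov : G.owner v = q := by rw [hG.owner, hv, ho]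
    by_cases ht : (f v).2 + 1 < k
    · obtain ⟨w, hw⟩ := hY _ hu _ ht
      refine mem_attr_of_own hvY hov (w := w) ((hG.move v w).2 (.inl (by rw [hw, hv]; simp))) ?_
      exact ih (k - (f w).2) (by rw [hw]; simp only; omega) (by rw [hw]) rfl
    · obtain ⟨w, hw⟩ := hY x hx 0 (by omega)
      refine mem_attr_of_own hvY hov (w := w) ((hG.move v w).2 (.inr ?_)) (hA w (by rw [hw]))
      rw [hw, hv]
      exact ⟨by omega, rfl, hm⟩

theorem reaches_of_move (hG : G.Inflates H k f) (hY : Full k f Y) {u x : K}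
    (hu : u ∈ Y) (hx : x ∈ Y) (hm : H.move u x) {v w : V} (hv : (f v).1 = u) (hw : f w = (x, 0)) :
    Relation.ReflTransGen (fun a b => a ∈ blk f Y ∧ b ∈ blk f Y ∧ G.move a b) v w := by
  induction hn : k - (f v).2 using Nat.strong_induction_on generalizing v with
  | _ n ih =>
    have hlt := hG.lt v
    have hvY : v ∈ blk f Y := mem_blk.2 (hv ▸ hu)
    by_cases ht : (f v).2 + 1 < k
    · obtain ⟨w', hw'⟩ := hY _ hu _ ht
      refine .head (b := w') ⟨hvY, mem_blk.2 (by rw [hw']; exact hu),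
        (hG.move v w').2 (.inl (by rw [hw', hv]; simp))⟩ ?_
      exact ih (k - (f w').2) (by rw [hw']; simp only; omega) (by rw [hw']) rfl
    · refine .single ⟨hvY, mem_blk.2 (by rw [hw]; exact hx), (hG.move v w).2 (.inr ?_)⟩
      rw [hw, hv]
      exact ⟨by omega, rfl, hm⟩

/-- A nonempty walk of `H` is needed even if `u = x`: an earlier position of a path is reached again
only around a cycle. -/
theorem reaches_of_transGen (hG : G.Inflates H k f) (hY : Full k f Y) {u x : K}
    (h : Relation.TransGen (fun a b => a ∈ Y ∧ b ∈ Y ∧ H.move a b) u x) {v w : V}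
    (hv : (f v).1 = u) (hw : (f w).1 = x) :
    Relation.ReflTransGen (fun a b => a ∈ blk f Y ∧ b ∈ blk f Y ∧ G.move a b) v w := by
  have hxY : x ∈ Y := by
    obtain ⟨_, -, h⟩ := Relation.TransGen.tail'_iff.1 h
    exact h.2.1
  have h₀ : ∀ w₀, f w₀ = (x, 0) →
      Relation.ReflTransGen (fun a b => a ∈ blk f Y ∧ b ∈ blk f Y ∧ G.move a b) v w₀ := by
    clear hw hxY
    intro w₀ hw₀
    induction h generalizing w₀ with
    | single h => exact reaches_of_move hG hY h.1 h.2.1 h.2.2 hv hw₀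
    | tail _ h ih =>
      obtain ⟨w', hw'⟩ := hY _ h.1 0 (by have := hG.lt v; omega)
      exact (ih w' hw').trans (reaches_of_move hG hY h.1 h.2.1 h.2.2 (by rw [hw']) hw₀)
  have : ∀ t, ∀ w, f w = (x, t) →
      Relation.ReflTransGen (fun a b => a ∈ blk f Y ∧ b ∈ blk f Y ∧ G.move a b) v w := by
    intro t
    induction t with
    | zero => exact h₀
    | succ t ih =>
      intro w hw
      have hlt := hG.lt w
      rw [hw] at hlt
      obtain ⟨w', hw'⟩ := hY x hxY t (by simp only at hlt; omega)
      exact (ih w' hw').tail ⟨mem_blk.2 (by rw [hw']; exact hxY),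
        mem_blk.2 (by rw [hw]; exact hxY), (hG.move w' w).2 (.inl (by rw [hw, hw']; simp))⟩
  exact this _ w (by rw [← hw])

theorem isBottomSCC_blk (hG : G.Inflates H k f) (hY : Full k f Y) (hne : (blk f Y).Nonempty)
    (h : ∀ u ∈ Y, ∀ x ∈ Y, Relation.TransGen (fun a b => a ∈ Y ∧ b ∈ Y ∧ H.move a b) u x)
    {X : Finset V} (hX : blk f Y ⊆ X)
    (hclosed : ∀ v ∈ blk f Y, ∀ w ∈ X, G.move v w → w ∈ blk f Y) :
    G.IsBottomSCC X (blk f Y) := by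
  refine ⟨hne, hX, fun v hv w => ⟨fun hw => ?_, fun hw => ?_⟩⟩
  · exact Relation.ReflTransGen.mono (fun a b h => ⟨hX h.1, hX h.2.1, h.2.2⟩) _ _
      (reaches_of_transGen hG hY (h _ (mem_blk.1 hv) _ (mem_blk.1 hw)) rfl rfl)
  · induction hw with
    | refl => exact hv
    | tail _ h ih => exact hclosed _ ih _ h.2.1 h.2.2

/-- From every position of `D` some move stays in `D`. Moves inside a path are unique, so `D` runs
to the end of a path, enters a path at its start, and contains all of the latter. -/
theorem card_dominion (hG : G.Inflates H k f) (hY : Full k f Y)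
    (htot : ∀ u ∈ Y, ∃ x ∈ Y, H.move u x) {D : Finset V} (hD : G.IsDominion (blk f Y) q D)
    (hne : D.Nonempty) : k ≤ D.card := by
  obtain ⟨hDY, hDc, σ, hσ, -⟩ := hD
  have hstep : ∀ v ∈ D, ∃ w ∈ D, G.move v w := by
    intro v hv
    by_cases ho : G.owner v = q
    · exact ⟨σ v, (hσ v hv ho).2, (hσ v hv ho).1⟩
    · have hvY := mem_blk.1 (hDY hv)
      have hlt := hG.lt v
      have : ∃ w ∈ blk f Y, G.move v w := by
        by_cases ht : (f v).2 + 1 < k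
        · obtain ⟨w, hw⟩ := hY _ hvY _ ht
          exact ⟨w, mem_blk.2 (by rw [hw]; exact hvY), (hG.move v w).2 (.inl (by rw [hw]; simp))⟩
        · obtain ⟨x, hx, hm⟩ := htot _ hvY
          obtain ⟨w, hw⟩ := hY x hx 0 (by omega)
          exact ⟨w, mem_blk.2 (by rw [hw]; exact hx),
            (hG.move v w).2 (.inr (by rw [hw]; exact ⟨by omega, rfl, hm⟩))⟩
      obtain ⟨w, hw, hm⟩ := this
      exact ⟨w, hDc v hv ho w hw hm, hm⟩
  have hpath : ∀ v ∈ D, ∀ n, (f v).2 + n < k → ∃ w ∈ D, f w = ((f v).1, (f v).2 + n) := by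
    intro v hv n
    induction n with
    | zero => exact fun _ => ⟨v, hv, rfl⟩
    | succ n ih =>
      intro hn
      obtain ⟨w, hw, hfw⟩ := ih (by omega)
      obtain ⟨x, hx, hm⟩ := hstep w hw
      refine ⟨x, hx, ?_⟩
      rcases (hG.move w x).1 hm with ⟨h1, h2⟩ | ⟨h1, -⟩
      · rw [hfw] at h1 h2
        exact Prod.ext h1 h2
      · rw [hfw] at h1
        simp only at h1
        omega
  obtain ⟨v, hv⟩ := hne
  have hlt := hG.lt v
  obtain ⟨w, hw, hfw⟩ := hpath v hv (k - 1 - (f v).2) (by omega)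
  obtain ⟨x, hx, hm⟩ := hstep w hw
  have hx0 : (f x).2 = 0 := by
    rcases (hG.move w x).1 hm with ⟨-, h2⟩ | ⟨-, h, -⟩
    · have := hG.lt x
      rw [hfw] at h2
      simp only at h2
      omega
    · exact h
  have hsub : Finset.range k ⊆ D.image fun v => (f v).2 := by
    intro t ht
    obtain ⟨y, hy, hfy⟩ := hpath x hx t (by rw [hx0, Nat.zero_add]; exact Finset.mem_range.1 ht)
    exact Finset.mem_image.2 ⟨y, hy, by rw [hfy]; simp [hx0]⟩
  simpa using (Finset.card_le_card hsub).trans Finset.card_image_le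

/-- A positional strategy of `H` that is certified by progress measures yields a dominion of the
inflated game. -/
theorem isDominion_blk (hG : G.Inflates H k f) (hY : Full k f Y) {D : Set K} (hDY : D ⊆ Y)
    (σ : K → K) (hclosed : ∀ u ∈ D, H.owner u ≠ q → ∀ w ∈ Y, H.move u w → w ∈ D)
    (hσ : ∀ u ∈ D, H.owner u = q → H.move u (σ u) ∧ σ u ∈ D)
    (hrank : ∀ m : ℕ, m.bodd ≠ q → ∃ r : K → ℕ, ∀ u ∈ D, ∀ w ∈ D, H.move u w →
      (H.owner u = q → w = σ u) → H.priority u ≤ m → H.priority w ≤ m →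
      r w ≤ r u ∧ (H.priority u = m → r w < r u)) :
    G.IsDominion (blk f Y) q (blk f D) := by
  classical
  have hex : ∀ v ∈ blk f D, G.owner v = q → ∃ w, G.move v w ∧ w ∈ blk f D ∧
      (H.move (f v).1 (f w).1 → (f v).2 + 1 = k → (f w).1 = σ (f v).1) := by
    intro v hv ho
    rw [mem_blk] at hv
    rw [hG.owner] at ho
    have hlt := hG.lt v
    by_cases ht : (f v).2 + 1 < k
    · obtain ⟨w, hw⟩ := hY _ (hDY hv) _ ht
      exact ⟨w, (hG.move v w).2 (.inl (by rw [hw]; simp)), mem_blk.2 (by rw [hw]; exact hv),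
        fun _ h => by omega⟩
    · obtain ⟨w, hw⟩ := hY _ (hDY (hσ _ hv ho).2) 0 (by omega)
      exact ⟨w, (hG.move v w).2 (.inr (by rw [hw]; exact ⟨by omega, rfl, (hσ _ hv ho).1⟩)),
        mem_blk.2 (by rw [hw]; exact (hσ _ hv ho).2), fun _ _ => by rw [hw]⟩
  choose! s hs using hex
  refine ⟨blk_subset hDY, ?_, s, fun v hv ho => ⟨(hs v hv ho).1, (hs v hv ho).2.1⟩, ?_⟩
  · intro v hv ho w hw hm
    rw [mem_blk] at hv hw ⊢
    rw [hG.owner] at ho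
    rcases (hG.move v w).1 hm with ⟨h, -⟩ | ⟨-, -, h⟩
    · rwa [h]
    · exact hclosed _ hv ho _ hw h
  · intro π hπ
    -- If the largest recurring priority had the wrong parity, a natural-number rank would finally
    -- be nonincreasing and still drop infinitely often.
    obtain ⟨m, hfr, hev⟩ := exists_recurring_max (fun i => G.priority (π i))
      (Finset.univ.sup G.priority) fun i => Finset.le_sup (Finset.mem_univ _)
    by_cases hm : m.bodd = q
    · exact ⟨m, hm, hfr, hev⟩
    exfalso
    obtain ⟨r, hr⟩ := hrank m hm
    obtain ⟨N, hN⟩ := eventually_atTop.1 hev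
    -- On a path of priority `m` each of the `k` moves must lower the rank, so ranks are scaled by
    -- `k`. The summand `1` keeps the subtraction from truncating.
    let R : V → ℕ := fun v =>
      if H.priority (f v).1 = m then k * (r (f v).1 + 1) - (f v).2 else k * (r (f v).1 + 1)
    have hR : ∀ i ≥ N, R (π (i + 1)) ≤ R (π i) ∧
        (G.priority (π i) = m → R (π (i + 1)) < R (π i)) := by
      intro i hi
      obtain ⟨hin, hmv, hst⟩ := hπ i
      have hin' := mem_blk.1 (hπ (i + 1)).1
      have hp := hN i hi
      have hp' := hN (i + 1) (by omega)
      have hlt := hG.lt (π i)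
      simp only [hG.priority] at hp hp' ⊢
      rcases (hG.move _ _).1 hmv with ⟨h1, h2⟩ | ⟨h1, h2, h3⟩
      · have hk : k ≤ k * (r (f (π i)).1 + 1) := Nat.le_mul_of_pos_right _ (by omega)
        simp only [R, h1, h2]
        split_ifs with h
        · exact ⟨by omega, fun _ => by omega⟩
        · exact ⟨le_rfl, fun h' => absurd h' h⟩
      · have := hr _ (mem_blk.1 hin) _ hin' h3 (fun ho => by
          have hst := hst (by rw [hG.owner, ho])
          have := (hs _ hin (by rw [hG.owner, ho])).2.2
          rw [← hst] at this
          exact this h3 h1) hp hp'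
        have hle : R (π (i + 1)) ≤ k * (r (f (π (i + 1))).1 + 1) := by
          simp only [R]
          split_ifs <;> omega
        by_cases h : H.priority (f (π i)).1 = m
        · have h5 : k * (r (f (π (i + 1))).1 + 1) ≤ k * r (f (π i)).1 :=
            Nat.mul_le_mul_left _ (this.2 h)
          have h6 : R (π i) = k * r (f (π i)).1 + k - (f (π i)).2 := by
            simp only [R, h, if_true, Nat.mul_add, Nat.mul_one]
          exact ⟨by omega, fun _ => by omega⟩
        · have h5 : k * (r (f (π (i + 1))).1 + 1) ≤ k * (r (f (π i)).1 + 1) :=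
            Nat.mul_le_mul_left _ (by omega)
          have h6 : R (π i) = k * (r (f (π i)).1 + 1) := by
            simp only [R, h, if_false]
          exact ⟨by omega, fun h' => absurd h' h⟩
    refine not_frequently_decreasing (R := fun i => R (π i)) (fun i hi => (hR i hi).1) ?_
    refine (hfr.and_eventually (eventually_ge_atTop N)).mono fun i hi => (hR i hi.2).2 hi.1

end Inflation

/-! ### The core game. -/

/-- The positions of the core game; `a j`, `b j`, `c j`, `d j` form level `j`. -/
inductive Pos : Type
  | hub (q : Bool)
  | a (j : ℕ)
  | b (j : ℕ)
  | c (j : ℕ)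
  | d (j : ℕ)
  | pad

namespace Pos

/-- The owners of the core game. -/
def owner : Pos → Player
  | hub q => q
  | a j => !j.bodd
  | b j => j.bodd
  | c j => j.bodd
  | d j => !j.bodd
  | pad => false

/-- The priorities of the core game. -/
def priority : Pos → ℕ
  | hub _ => 0
  | a j => j + 2
  | b _ => 0
  | c j => if j.bodd then 0 else 1
  | d j => if j.bodd then 0 else 1
  | pad => 0

/-- The moves of the core game. -/
def Move : Pos → Pos → Prop
  | hub q, hub r => r = !q
  | hub q, b j => q = !j.bodd
  | hub q, c j => q = true ∧ j = 0
  | hub q, d j => q = j.bodd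
  | a _, hub q => q = true
  | a j, c l => l = j
  | b j, hub q => q = j.bodd
  | b j, a l => l = j
  | c j, a l => l = j + 1
  | c j, d l => l = j
  | d j, hub q => q = !j.bodd
  | d j, c l => l = j
  | pad, hub q => q = false
  | _, _ => False

/-- The core game, with infinitely many levels. -/
def game : ParityGame Pos where
  owner := owner
  move := Move
  priority := priority
  total v := by
    cases v with
    | hub q => exact ⟨hub (!q), rfl⟩
    | a j => exact ⟨c j, rfl⟩
    | b j => exact ⟨a j, rfl⟩
    | c j => exact ⟨d j, rfl⟩
    | d j => exact ⟨c j, rfl⟩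
    | pad => exact ⟨hub false, rfl⟩

/-- The positions of the levels below `n`. -/
def core (n : ℕ) : Set Pos := fun u =>
  match u with
  | hub _ => True
  | a j => j < n
  | b j => j < n
  | c j => j < n
  | d j => j < n
  | pad => False

/-- Sets of core positions that form a strongly connected subgame. -/
structure Admissible (n : ℕ) (Y : Set Pos) : Prop where
  sub : Y ⊆ core n
  hub : ∀ q, hub q ∈ Y
  ab : ∀ j, a j ∈ Y → b j ∈ Y
  cd : ∀ j, c j ∈ Y → d j ∈ Y

theorem Admissible.pad_notMem {n : ℕ} {Y : Set Pos} (h : Admissible n Y) : pad ∉ Y :=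
  fun hp => h.sub hp

theorem Admissible.exists_move {n : ℕ} {Y : Set Pos} (h : Admissible n Y) :
    ∀ u ∈ Y, ∃ x ∈ Y, game.move u x := by
  intro u hu
  cases u with
  | hub q => exact ⟨Pos.hub (!q), h.hub _, rfl⟩
  | a j => exact ⟨Pos.hub true, h.hub _, rfl⟩
  | b j => exact ⟨Pos.hub j.bodd, h.hub _, rfl⟩
  | c j => exact ⟨d j, h.cd _ hu, rfl⟩
  | d j => exact ⟨Pos.hub (!j.bodd), h.hub _, rfl⟩
  | pad => exact absurd hu h.pad_notMem

/-- Every position is linked with the hubs in both directions: `a j` is entered through `b j`, while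
`c j` is entered and left through `d j`. -/
theorem Admissible.transGen {n : ℕ} {Y : Set Pos} (h : Admissible n Y) :
    ∀ u ∈ Y, ∀ x ∈ Y, Relation.TransGen (fun a b => a ∈ Y ∧ b ∈ Y ∧ game.move a b) u x := by
  have hh : ∀ q r, Relation.TransGen (fun a b => a ∈ Y ∧ b ∈ Y ∧ game.move a b)
      (Pos.hub q) (Pos.hub r) := by
    have h1 : ∀ q, Relation.TransGen (fun a b => a ∈ Y ∧ b ∈ Y ∧ game.move a b)
      (Pos.hub q) (Pos.hub (!q)) := fun q => .single ⟨h.hub _, h.hub _, rfl⟩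
    intro q r
    by_cases hr : r = q
    · have := (h1 q).trans (h1 (!q))
      rw [Bool.not_not] at this
      rwa [hr]
    · rw [eq_not_of_ne hr]
      exact h1 q
  have h1 : ∀ u ∈ Y, Relation.TransGen (fun a b => a ∈ Y ∧ b ∈ Y ∧ game.move a b)
      u (Pos.hub false) := by
    intro u hu
    have hd : ∀ j, d j ∈ Y → Relation.TransGen (fun a b => a ∈ Y ∧ b ∈ Y ∧ game.move a b)
      (d j) (Pos.hub false) := fun j hj => .head ⟨hj, h.hub (!j.bodd), rfl⟩ (hh _ _)
    cases u with
    | hub q => exact hh _ _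
    | a j => exact .head ⟨hu, h.hub true, rfl⟩ (hh _ _)
    | b j => exact .head ⟨hu, h.hub j.bodd, rfl⟩ (hh _ _)
    | c j => exact .head ⟨hu, h.cd _ hu, rfl⟩ (hd j (h.cd _ hu))
    | d j => exact hd j hu
    | pad => exact absurd hu h.pad_notMem
  have h2 : ∀ u ∈ Y, Relation.TransGen (fun a b => a ∈ Y ∧ b ∈ Y ∧ game.move a b)
      (Pos.hub false) u := by
    intro u hu
    have hd : ∀ j, d j ∈ Y → Relation.TransGen (fun a b => a ∈ Y ∧ b ∈ Y ∧ game.move a b)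
      (Pos.hub false) (d j) := fun j hj => (hh _ _).tail ⟨h.hub j.bodd, hj, rfl⟩
    have hb : ∀ j, b j ∈ Y → Relation.TransGen (fun a b => a ∈ Y ∧ b ∈ Y ∧ game.move a b)
      (Pos.hub false) (b j) := fun j hj => (hh _ _).tail ⟨h.hub (!j.bodd), hj, rfl⟩
    cases u with
    | hub q => exact hh _ _
    | a j => exact (hb j (h.ab j hu)).tail ⟨h.ab j hu, hu, rfl⟩
    | b j => exact hb j hu
    | c j => exact (hd j (h.cd j hu)).tail ⟨h.cd j hu, hu, rfl⟩
    | d j => exact hd j hu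
    | pad => exact absurd hu h.pad_notMem
  exact fun u hu x hx => (h1 u hu).trans (h2 x hx)

/-! ### Left and right subgames of a stage. -/

/-- Level `i` is the highest level with a position `a i`; the levels below are complete. -/
structure Stage (n i : ℕ) (Y : Set Pos) : Prop extends Admissible n Y where
  a_low : ∀ j < i, a j ∈ Y
  c_low : ∀ j < i, c j ∈ Y
  a_mem : a i ∈ Y
  d_mem : d i ∈ Y
  a_high : ∀ j > i, a j ∉ Y

/-- The pairs `c j`, `d j` of parity `p` on the levels from `i` on. -/
def pairs (p : Player) (i : ℕ) (Y : Set Pos) : Set Pos := fun u =>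
  match u with
  | c j => i ≤ j ∧ j.bodd = p ∧ c j ∈ Y
  | d j => i ≤ j ∧ j.bodd = p ∧ c j ∈ Y
  | _ => False

section
variable {p : Player} {i j : ℕ} {Y : Set Pos} {q : Bool}

@[simp] theorem hub_notMem_pairs : ¬ hub q ∈ pairs p i Y := id
@[simp] theorem a_notMem_pairs : ¬ a j ∈ pairs p i Y := id
@[simp] theorem b_notMem_pairs : ¬ b j ∈ pairs p i Y := id
@[simp] theorem pad_notMem_pairs : ¬ pad ∈ pairs p i Y := id
@[simp] theorem c_mem_pairs : c j ∈ pairs p i Y ↔ i ≤ j ∧ j.bodd = p ∧ c j ∈ Y := Iff.rfl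
@[simp] theorem d_mem_pairs : d j ∈ pairs p i Y ↔ i ≤ j ∧ j.bodd = p ∧ c j ∈ Y := Iff.rfl

end

theorem pairs_subset {p : Player} {i n : ℕ} {Y : Set Pos} (h : Admissible n Y) :
    pairs p i Y ⊆ Y := by
  intro u hu
  cases u with
  | c j => exact hu.2.2
  | d j => exact h.cd _ hu.2.2
  | hub q => exact hu.elim
  | a j => exact hu.elim
  | b j => exact hu.elim
  | pad => exact hu.elim

variable {V : Type} [DecidableEq V] [Fintype V] {G : ParityGame V} {k n m i : ℕ} {f : V → Pos × ℕ}
  {Y : Set Pos}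

theorem Admissible.full (h : Admissible n Y) (hf : Full k f (core n)) : Full k f Y :=
  fun u hu => hf u (h.sub hu)

theorem Stage.priority_le (h : Stage n i Y) {u : Pos} (hu : u ∈ Y) : game.priority u ≤ i + 2 := by
  cases u with
  | a j =>
    have : ¬ j > i := fun hj => h.a_high j hj hu
    simp only [game, priority]; omega
  | c j => simp only [game, priority]; split_ifs <;> omega
  | d j => simp only [game, priority]; split_ifs <;> omega
  | hub q => simp [game, priority]
  | b j => simp [game, priority]
  | pad => simp [game, priority]

theorem eq_of_priority {u : Pos} (hu : game.priority u = i + 2) :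
    u = a i := by
  cases u with
  | a j => simp only [game, priority] at hu; rw [show j = i by omega]
  | c j => simp only [game, priority] at hu; split_ifs at hu; omega
  | d j => simp only [game, priority] at hu; split_ifs at hu; omega
  | hub q => simp [game, priority] at hu
  | b j => simp [game, priority] at hu
  | pad => simp [game, priority] at hu

theorem Stage.maxPriority (h : Stage n i Y) (hG : G.Inflates game k f) (hf : Full k f (core n))
    (hk : 0 < k) : G.maxPriority (blk f Y) = i + 2 := by
  refine le_antisymm (Finset.sup_le fun v hv => ?_) ?_
  · rw [hG.priority]; exact h.priority_le (mem_blk.1 hv)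
  · obtain ⟨v, hv⟩ := h.full hf _ h.a_mem 0 hk
    have := priority_le_maxPriority (G := G) (X := blk f Y) (v := v)
      (mem_blk.2 (by rw [hv]; exact h.a_mem))
    rw [hG.priority, hv] at this
    exact this

theorem Stage.leader (h : Stage n i Y) (hG : G.Inflates game k f) (hf : Full k f (core n))
    (hk : 0 < k) : G.leader (blk f Y) = i.bodd := by
  rw [ParityGame.leader, h.maxPriority hG hf hk]
  simp

theorem Stage.maxPositions (h : Stage n i Y) (hG : G.Inflates game k f) (hf : Full k f (core n))
    (hk : 0 < k) : G.maxPositions (blk f Y) = blk f {a i} := by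
  ext v
  rw [ParityGame.maxPositions, Finset.mem_filter, h.maxPriority hG hf hk, mem_blk, mem_blk,
    hG.priority, Set.mem_singleton_iff]
  refine ⟨fun hv => eq_of_priority hv.2, fun hv => ?_⟩
  rw [hv]
  exact ⟨h.a_mem, rfl⟩

/-- The leader owns `b i`. The other possible predecessor of `a i`, the `c` of the level below,
belongs to the opponent, who escapes to the `d` beside it. -/
theorem Stage.attr_max (h : Stage n i Y) (hG : G.Inflates game k f) (hf : Full k f (core n)) :
    G.attr (blk f Y) i.bodd (blk f {a i}) = blk f {a i, b i} := by
  refine subset_antisymm (attr_blk_subset hG (h.full hf) (by simp) ?_ ?_) ?_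
  · rintro u ⟨hu, huA⟩ ho x hx hm hxA
    rcases hxA with rfl | rfl
    · cases u <;> simp_all [game, Move, owner]
    · cases u <;> simp_all [game, Move, owner]
  · rintro u ⟨hu, huA⟩ ho
    cases u with
    | hub q => exact ⟨hub (!q), ⟨h.hub _, by simp⟩, rfl⟩
    | a j => exact ⟨hub true, ⟨h.hub _, by simp⟩, rfl⟩
    | b j => exact ⟨hub j.bodd, ⟨h.hub _, by simp⟩, rfl⟩
    | c j => exact ⟨d j, ⟨h.cd _ hu, by simp⟩, rfl⟩
    | d j => exact ⟨hub (!j.bodd), ⟨h.hub _, by simp⟩, rfl⟩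
    | pad => exact absurd hu h.pad_notMem
  · have h1 : ∀ v, (f v).1 = a i → v ∈ G.attr (blk f Y) i.bodd (blk f {a i}) := fun v hv =>
      subset_attr (blk_subset (by simpa using h.a_mem)) (mem_blk.2 hv)
    intro v hv
    rcases mem_blk.1 hv with hv | hv
    · exact h1 v hv
    · exact mem_attr_blk_own hG (h.full hf) (h.ab i h.a_mem) rfl h.a_mem rfl h1 hv

theorem Stage.leftGame (h : Stage n i Y) (hG : G.Inflates game k f) (hf : Full k f (core n))
    (hk : 0 < k) : G.leftGame (blk f Y) = blk f (Y \ {a i, b i}) := by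
  rw [ParityGame.leftGame, h.leader hG hf hk, h.maxPositions hG hf hk, h.attr_max hG hf, blk_sdiff]

theorem Stage.left (h : Stage n (i + 1) Y) : Stage n i (Y \ {a (i + 1), b (i + 1)}) where
  sub := Set.sdiff_subset.trans h.sub
  hub q := ⟨h.hub q, by simp⟩
  ab j hj := ⟨h.ab j hj.1, by have := hj.2; simp at this ⊢; exact this⟩
  cd j hj := ⟨h.cd j hj.1, by simp⟩
  a_low j hj := ⟨h.a_low j (by omega), by simp; omega⟩
  c_low j hj := ⟨h.c_low j (by omega), by simp⟩
  a_mem := ⟨h.a_low i (by omega), by simp⟩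
  d_mem := ⟨h.cd i (h.c_low i (by omega)), by simp⟩
  a_high j hj hm := by
    have := hm.2
    simp at this
    exact h.a_high j (by omega) hm.1

theorem Stage.left_c_mem (h : Stage n (i + 1) Y) : c i ∈ Y \ {a (i + 1), b (i + 1)} :=
  ⟨h.c_low i (by omega), by simp⟩

/-- The region to be removed before the right call. -/
def rightAttr (i : ℕ) (Y : Set Pos) : Set Pos :=
  pairs (!i.bodd) (i + 1) Y ∪ {a (i + 1), c i}

/-- The position `c i` is lost, but `Stage` asks only for `d i` on the top level. This suffices for
a subsequent left call, though not for the argument that forces a right call. -/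
theorem Stage.right (h : Stage n (i + 1) Y) : Stage n i (Y \ rightAttr i Y) where
  sub := Set.sdiff_subset.trans h.sub
  hub q := ⟨h.hub q, by simp [rightAttr]⟩
  ab j hj := ⟨h.ab j hj.1, by simp [rightAttr]⟩
  cd j hj := ⟨h.cd j hj.1, by
    have := hj.2; have h1 := hj.1
    simp [rightAttr] at this ⊢; tauto⟩
  a_low j hj := ⟨h.a_low j (by omega), by simp [rightAttr]; omega⟩
  c_low j hj := ⟨h.c_low j (by omega), by simp [rightAttr]; omega⟩
  a_mem := ⟨h.a_low i (by omega), by simp [rightAttr]⟩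
  d_mem := ⟨h.cd i (h.c_low i (by omega)), by simp [rightAttr]⟩
  a_high j hj hm := by
    have := hm.2
    simp [rightAttr] at this
    exact h.a_high j (by omega) hm.1

/-- The attracting player owns the chain from `c i` through `a (i + 1)` to `c (i + 1)`. All other
predecessors, among them `b (i + 1)`, belong to the other player and can move to a hub. -/
theorem Stage.attr_pairs (h : Stage n (i + 1) Y) (hc : c (i + 1) ∈ Y) (hi : 1 ≤ i)
    (hG : G.Inflates game k f) (hf : Full k f (core n)) :
    G.attr (blk f Y) i.bodd (blk f (pairs (!i.bodd) (i + 1) Y)) = blk f (rightAttr i Y) := by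
  have hs := h.right
  refine subset_antisymm (attr_blk_subset hG (h.full hf) Set.subset_union_left ?_ ?_) ?_
  · rintro u ⟨hu, huA⟩ ho x hx hm hxA
    have hah := h.a_high
    cases u with
    | hub q =>
      cases x <;> simp_all [game, Move, owner, rightAttr]
      omega
    | a j =>
      have hj : ¬ j > i + 1 := fun hl => hah j hl hu
      cases x <;> simp_all [game, Move, owner, rightAttr]
      rcases hxA with rfl | hxA
      · simp at ho
      · omega
    | b j =>
      cases x <;> simp_all [game, Move, owner, rightAttr]
      subst hm
      simp at ho
    | c j =>
      cases x <;> simp_all [game, Move, owner, rightAttr]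
    | d j =>
      cases x with
      | c l =>
        obtain rfl : l = j := hm
        simp only [game, owner] at ho
        rcases hxA with hxA | hxA | hxA
        · exact huA (.inl hxA)
        · cases hxA
        · cases hxA
          simp at ho
      | _ => simp_all [game, Move, owner, rightAttr]
    | pad => exact h.pad_notMem hu
  · rintro u ⟨hu, huA⟩ ho
    cases u with
    | hub q => exact ⟨hub (!q), ⟨h.hub _, by simp [rightAttr]⟩, rfl⟩
    | a j => exact ⟨hub true, ⟨h.hub _, by simp [rightAttr]⟩, rfl⟩
    | b j => exact ⟨hub j.bodd, ⟨h.hub _, by simp [rightAttr]⟩, rfl⟩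
    | c j => exact ⟨d j, hs.cd _ ⟨hu, huA⟩, rfl⟩
    | d j => exact ⟨hub (!j.bodd), ⟨h.hub _, by simp [rightAttr]⟩, rfl⟩
    | pad => exact absurd hu h.pad_notMem
  · have hPY : pairs (!i.bodd) (i + 1) Y ⊆ Y := pairs_subset h.toAdmissible
    have hp : ∀ v, (f v).1 ∈ pairs (!i.bodd) (i + 1) Y →
        v ∈ G.attr (blk f Y) i.bodd (blk f (pairs (!i.bodd) (i + 1) Y)) := fun v hv =>
      subset_attr (blk_subset hPY) (mem_blk.2 hv)
    have ha : ∀ v, (f v).1 = a (i + 1) →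
        v ∈ G.attr (blk f Y) i.bodd (blk f (pairs (!i.bodd) (i + 1) Y)) := fun v hv =>
      mem_attr_blk_own hG (h.full hf) (x := c (i + 1)) h.a_mem (by simp [game, owner]) hc rfl
        (fun w hw => hp w (by rw [hw]; exact ⟨le_rfl, by simp, hc⟩)) hv
    intro v hv
    rcases mem_blk.1 hv with hv | hv | hv
    · exact hp v hv
    · exact ha v hv
    · exact mem_attr_blk_own hG (h.full hf) (h.c_low i (by omega)) rfl h.a_mem rfl ha hv

/-! ### Winning regions of a stage. -/

theorem Stage.a_le (h : Stage n i Y) {j : ℕ} (hj : a j ∈ Y) : j ≤ i := by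
  by_contra hlt
  exact h.a_high j (by omega) hj

theorem Stage.c_le (h : Stage n i Y) (hc : c i ∈ Y) {j : ℕ} (hj : j ≤ i) : c j ∈ Y := by
  rcases hj.lt_or_eq with hj | rfl
  · exact h.c_low j hj
  · exact hc

/-- Above level `i` the exit from `c j` to `a (j + 1)` is missing, and player `i.bodd` owns `d j`
and can return to `c j` forever. The priority of the pair, 1 for even `j` and 0 for odd `j`, has the
parity of this player. -/
theorem Stage.dominion_pairs (h : Stage n i Y) (hG : G.Inflates game k f)
    (hf : Full k f (core n)) :
    G.IsDominion (blk f Y) i.bodd (blk f (pairs (!i.bodd) (i + 1) Y)) := by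
  let σ : Pos → Pos := fun u => match u with
    | d j => c j
    | u => u
  refine isDominion_blk hG (h.full hf) (pairs_subset h.toAdmissible) σ ?_ ?_ ?_
  · intro u hu ho w hw hm
    cases u with
    | c j =>
      cases w with
      | a l =>
        obtain rfl : l = j + 1 := hm
        have := h.a_le hw
        have := hu.1
        omega
      | d l =>
        obtain rfl : l = j := hm
        exact hu
      | _ => exact hm.elim
    | d j => simp_all [game, owner]
    | _ => exact hu.elim
  · intro u hu ho
    cases u with
    | c j => simp_all [game, owner]
    | d j => exact ⟨rfl, hu⟩
    | _ => exact hu.elim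
  · intro m hm
    refine ⟨fun _ => 0, fun u hu w _ _ _ _ _ => ⟨le_rfl, fun hp => absurd ?_ hm⟩⟩
    subst hp
    cases u with
    | c j => simp only [c_mem_pairs] at hu; cases hj : j.bodd <;> simp_all [game, priority]
    | d j => simp only [d_mem_pairs] at hu; cases hj : j.bodd <;> simp_all [game, priority]
    | _ => exact hu.elim

open Classical in
/-- The winning strategy of the opponent of the leader. -/
noncomputable def strategy (q : Player) (Y : Set Pos) : Pos → Pos
  | hub _ => if q then c 0 else hub true
  | a j => c j
  | b j => hub j.bodd
  | c j => a (j + 1)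
  | d j => if c j ∈ Y then c j else hub (!j.bodd)
  | pad => hub false

/-- The ranks that count the moves between visits to `c 0`. -/
def evenRank : Pos → ℕ
  | hub true => 0
  | hub false => 2
  | b j => if j.bodd then 1 else 3
  | d _ => 3
  | _ => 0

/-- The ranks that count the positions of priority `1` up to the next position of a higher
priority. -/
def oddRank : Pos → ℕ
  | c j => if j.bodd then 1 else 0
  | d j => if j.bodd then 1 else 2
  | _ => 1

/-- Odd answers `hub true` with `c 0`, of priority 1, so that no consistent cycle has priority 0
only. -/
theorem evenRank_lt {u w : Pos} (hm : game.move u w) (ho : game.owner u = true → w = strategy true Y u)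
    (hu : game.priority u = 0) (hw : game.priority w = 0) (hp : u ≠ pad) :
    evenRank w < evenRank u := by
  cases u with
  | hub q =>
    cases q
    · cases w with
      | hub r => obtain rfl : r = true := hm; simp [evenRank]
      | b j => have hm : false = !j.bodd := hm; simp_all [evenRank]
      | c j => simp [game, Move] at hm
      | d j => have hm : false = j.bodd := hm; simp [game, priority, ← hm] at hw
      | _ => exact hm.elim
    · rw [ho rfl] at hw
      simp [game, priority, strategy] at hw
  | a j => simp [game, priority] at hu
  | b j =>
    cases w with
    | hub r => obtain rfl : r = j.bodd := hm; cases hj : j.bodd <;> simp [evenRank, hj]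
    | a l => simp [game, priority] at hw
    | _ => exact hm.elim
  | c j =>
    have hj : j.bodd = true := by
      by_contra hj
      simp [game, priority, hj] at hu
    rw [ho hj] at hw
    simp [game, priority, strategy] at hw
  | d j =>
    have hj : j.bodd = true := by
      by_contra hj
      simp [game, priority, hj] at hu
    cases w with
    | hub r => obtain rfl : r = !j.bodd := hm; simp [evenRank, hj]
    | c l => simp [evenRank]
    | _ => exact hm.elim
  | pad => exact absurd rfl hp

/-- Even leaves `c j` with `j` even for `a (j + 1)`, so priority 1 cannot recur without a higher
priority. -/
theorem oddRank_le {u w : Pos} (hm : game.move u w)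
    (ho : game.owner u = false → w = strategy false Y u)
    (hu : game.priority u ≤ 1) (hw : game.priority w ≤ 1) :
    oddRank w ≤ oddRank u ∧ (game.priority u = 1 → oddRank w < oddRank u) := by
  cases u with
  | hub q =>
    refine ⟨?_, by simp [game, priority]⟩
    cases q
    · rw [ho rfl]
      simp [oddRank, strategy]
    · cases w with
      | hub r => simp [oddRank]
      | b j => simp [oddRank]
      | c j => simp only [oddRank]; split_ifs <;> simp
      | d j => have hm : true = j.bodd := hm; simp [oddRank, ← hm]
      | _ => exact hm.elim
  | a j => simp [game, priority] at hu
  | b j =>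
    refine ⟨?_, by simp [game, priority]⟩
    cases w with
    | hub r => simp [oddRank]
    | a l => simp [game, priority] at hw
    | _ => exact hm.elim
  | c j =>
    cases hj : j.bodd
    · rw [ho hj] at hw
      simp [game, priority, strategy] at hw
    · refine ⟨?_, by simp [game, priority, hj]⟩
      cases w with
      | a l => simp [game, priority] at hw
      | d l => obtain rfl : l = j := hm; simp [oddRank, hj]
      | _ => exact hm.elim
  | d j =>
    cases w with
    | hub r => cases hj : j.bodd <;> simp [oddRank, hj, game, priority]
    | c l => obtain rfl : l = j := hm; cases hj : l.bodd <;> simp [oddRank, hj, game, priority]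
    | _ => exact hm.elim
  | pad =>
    refine ⟨?_, by simp [game, priority]⟩
    cases w with
    | hub r => simp [oddRank]
    | _ => exact hm.elim

/-- The harmful high priorities are those of `a j` with `j` of the parity of `i`. They are answered
by `c j`, and `d j` is answered by `c j`, which confines the play to a pair of favourable priority.
The opponent can escape only to `a (j + 1)`, of larger and favourable priority. For `j = i` even
this exit is missing, and here `c i` is indispensable. -/
theorem Stage.dominion_rest (h : Stage n i Y) (hc : c i ∈ Y) (hG : G.Inflates game k f)
    (hf : Full k f (core n)) :
    G.IsDominion (blk f Y) (!i.bodd) (blk f (Y \ pairs (!i.bodd) (i + 1) Y)) := by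
  classical
  refine isDominion_blk hG (h.full hf) Set.sdiff_subset (strategy (!i.bodd) Y) ?_ ?_ ?_
  · rintro u ⟨hu, huT⟩ ho w hw hm
    refine ⟨hw, fun hwT => ?_⟩
    cases u with
    | hub q =>
      cases w with
      | c l =>
        obtain ⟨-, rfl⟩ := hm
        simpa using hwT.1
      | d l =>
        obtain rfl : q = l.bodd := hm
        exact ho hwT.2.1
      | _ => exact hwT.elim
    | a j =>
      cases w with
      | c l =>
        obtain rfl : l = j := hm
        have := h.a_le hu
        have := hwT.1
        omega
      | _ => first | exact hwT.elim | exact hm.elim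
    | c j =>
      cases w with
      | d l =>
        obtain rfl : l = j := hm
        exact huT hwT
      | _ => first | exact hwT.elim | exact hm.elim
    | d j =>
      cases w with
      | c l =>
        obtain rfl : l = j := hm
        exact huT hwT
      | _ => first | exact hwT.elim | exact hm.elim
    | b j => cases w <;> first | exact hwT.elim | exact hm.elim
    | pad => exact h.pad_notMem hu
  · rintro u ⟨hu, huT⟩ ho
    cases u with
    | hub q =>
      obtain rfl : q = !i.bodd := ho
      cases hi : i.bodd
      · exact ⟨⟨rfl, rfl⟩, h.c_le hc (Nat.zero_le _), by simp [strategy]⟩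
      · exact ⟨rfl, h.hub _, by simp [strategy]⟩
    | a j => exact ⟨rfl, h.c_le hc (h.a_le hu), fun hT => by have := hT.1; have := h.a_le hu; omega⟩
    | b j => exact ⟨rfl, h.hub _, hub_notMem_pairs⟩
    | c j =>
      have ho : j.bodd = !i.bodd := ho
      have h1 : ¬ i + 1 ≤ j := fun h1 => huT ⟨h1, ho, hu⟩
      have h2 : j ≠ i := by
        rintro rfl
        simp at ho
      refine ⟨rfl, ?_, a_notMem_pairs⟩
      by_cases h3 : j + 1 = i
      · rw [strategy, h3]; exact h.a_mem
      · exact h.a_low _ (by omega)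
    | d j =>
      by_cases hj : c j ∈ Y
      · simp only [strategy, hj, if_true]
        exact ⟨rfl, hj, huT⟩
      · simp only [strategy, hj, if_false]
        exact ⟨rfl, h.hub _, hub_notMem_pairs⟩
    | pad => exact absurd hu h.pad_notMem
  · intro m hm
    -- The harmful priorities: 0 for Odd, 1 for Even, and `j + 2`, which occurs only at `a j`.
    rcases m with _ | _ | j
    · have hi : (!i.bodd) = true := by
        revert hm; cases i.bodd <;> simp
      rw [hi]
      refine ⟨evenRank, fun u hu w _ hmv ho hpu hpw => ?_⟩
      have := evenRank_lt hmv ho (by omega) (by omega) fun hp => h.pad_notMem (hp ▸ hu.1)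
      exact ⟨this.le, fun _ => this⟩
    · have hi : (!i.bodd) = false := by
        revert hm; cases i.bodd <;> simp
      rw [hi]
      exact ⟨oddRank, fun u _ w _ hmv ho hpu hpw => oddRank_le hmv ho hpu hpw⟩
    · have hji : j.bodd = i.bodd := by
        revert hm
        simp only [Nat.bodd_succ]
        cases i.bodd <;> cases j.bodd <;> simp
      -- Rank 0 marks the pair of level `j`: after `a j` the play cannot leave it without exceeding
      -- priority `j + 2`.
      refine ⟨fun u => if j ≤ i ∧ (u = c j ∨ u = d j) then 0 else 1,
        fun u hu w hw hmv ho hpu hpw => ?_⟩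
      beta_reduce
      by_cases hpair : j ≤ i ∧ (u = c j ∨ u = d j)
      · obtain ⟨hj, rfl | rfl⟩ := hpair
        · refine ⟨?_, fun hp => by simp only [game, priority] at hp; split_ifs at hp; omega⟩
          cases w with
          | a l =>
            obtain rfl : l = j + 1 := hmv
            simp [game, priority] at hpw
          | d l =>
            obtain rfl : l = j := hmv
            simp [hj]
          | _ => exact hmv.elim
        · refine ⟨?_, fun hp => by simp only [game, priority] at hp; split_ifs at hp; omega⟩
          have : w = c j := by
            rw [ho (by simp [game, owner, hji]), strategy, if_pos (h.c_le hc hj)]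
          simp [this, hj]
      · rw [if_neg hpair]
        refine ⟨by split_ifs <;> simp, fun hp => ?_⟩
        have hu' : u = a j := eq_of_priority hp
        subst hu'
        have hj := h.a_le hu.1
        have : w = c j := ho (by simp [game, owner, hji])
        simp [this, hj]

/-- This is applied to the left subgame of level `i + 1`, where `i.bodd` is the opponent of the
leader of the full subgame. -/
theorem Stage.solves_leader (h : Stage n i Y) (hc : c i ∈ Y) (hG : G.Inflates game k f)
    (hf : Full k f (core n)) {W : Player → Finset V} (hW : G.Solves (blk f Y) W) :
    W i.bodd = blk f (pairs (!i.bodd) (i + 1) Y) :=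
  hW.eq_of_partition (h.dominion_pairs hG hf) (by rw [blk_sdiff]; exact h.dominion_rest hc hG hf)

theorem Stage.nonempty (h : Stage n i Y) (hf : Full k f (core n)) (hk : 0 < k) :
    (blk f Y).Nonempty := by
  obtain ⟨v, hv⟩ := h.full hf _ h.a_mem 0 hk
  exact ⟨v, mem_blk.2 (by rw [hv]; exact h.a_mem)⟩

theorem Stage.isBottomSCC (h : Stage n i Y) (hG : G.Inflates game k f) (hf : Full k f (core n))
    (hk : 0 < k) : G.IsBottomSCC (blk f Y) (blk f Y) :=
  isBottomSCC_blk hG (h.full hf) (h.nonempty hf hk) h.toAdmissible.transGen subset_rfl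
    fun _ _ _ hw _ => hw

theorem Stage.search (h : Stage n i Y) (hG : G.Inflates game k f) (hf : Full k f (core n))
    (l : ℕ) (L₁ : List (Finset V)) (D : Finset V) (L₂ : List (Finset V)) (p : Player)
    (hL : IsSearchOrder (blk f Y) l (L₁ ++ D :: L₂)) (hD : G.IsDominion (blk f Y) p D) :
    2 ^ k - 1 ≤ L₁.length + 1 := by
  have h1 := hL.two_pow_le
  have h2 := card_dominion hG (h.full hf) h.toAdmissible.exists_move hD ((hL.2.1 D).1 (by simp)).2.1
  have h3 : 2 ^ k ≤ 2 ^ D.card := Nat.pow_le_pow_right (by norm_num) h2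
  omega

/-! ### Forced calls and the number of records. -/

theorem Stage.forcedCall_left (h : Stage n (i + 1) Y) (hG : G.Inflates game k f)
    (hf : Full k f (core n)) (hk : 0 < k) :
    G.ForcedCall (2 ^ k - 1) (blk f Y) (blk f (Y \ {a (i + 1), b (i + 1)})) where
  scc := h.isBottomSCC hG hf hk
  nonempty := h.left.nonempty hf hk
  search := h.search hG hf
  call _ _ := .inl (h.leftGame hG hf hk).symm

theorem pairs_left (p : Player) (m l : ℕ) (Y : Set Pos) :
    pairs p m (Y \ {a l, b l}) = pairs p m Y := by
  ext u
  cases u <;> simp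

theorem Stage.forcedCall_right (h : Stage n (i + 1) Y) (hc : c (i + 1) ∈ Y) (hi : 1 ≤ i)
    (hG : G.Inflates game k f) (hf : Full k f (core n)) (hk : 0 < k) :
    G.ForcedCall (2 ^ k - 1) (blk f Y) (blk f (Y \ rightAttr i Y)) where
  scc := h.isBottomSCC hG hf hk
  nonempty := h.right.nonempty hf hk
  search := h.search hG hf
  call W hW := by
    rw [h.leftGame hG hf hk] at hW
    have hl : (!G.leader (blk f Y)) = i.bodd := by simp [h.leader hG hf hk]
    rw [hl, h.left.solves_leader h.left_c_mem hG hf hW, pairs_left]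
    refine .inr ⟨?_, ?_⟩
    · obtain ⟨v, hv⟩ := h.full hf _ h.a_mem (k - 1) (by omega)
      obtain ⟨w, hw⟩ := h.full hf _ hc 0 hk
      refine Finset.nonempty_iff_ne_empty.1 ⟨v, Finset.mem_sdiff.2 ⟨?_, ?_⟩⟩
      · refine mem_pre_of_own (w := w) (mem_blk.2 (by rw [hv]; exact h.a_mem)) ?_ ?_ ?_ ?_
        · rw [hG.owner, hv]; simp [game, owner]
        · exact mem_blk.2 (by rw [hw]; exact hc)
        · rw [hG.move, hv, hw]
          exact .inr ⟨by simp only; omega, rfl, rfl⟩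
        · exact mem_blk.2 (by rw [hw]; exact ⟨le_rfl, by simp, hc⟩)
      · rw [mem_blk, hv]; exact a_notMem_pairs
    · rw [rightGame, hl, h.attr_pairs hc hi hG hf, blk_sdiff]

theorem admissible_core (n : ℕ) : Admissible n (core n) :=
  ⟨subset_rfl, fun _ => trivial, fun _ h => h, fun _ h => h⟩

theorem stage_core (i : ℕ) : Stage (i + 1) i (core (i + 1)) where
  toAdmissible := admissible_core _
  a_low j hj := Nat.lt_succ_of_lt hj
  c_low j hj := Nat.lt_succ_of_lt hj
  a_mem := Nat.lt_succ_self i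
  d_mem := Nat.lt_succ_self i
  a_high j hj h := by
    have h : j < i + 1 := h
    omega

/-- The recorded subgames realize all combinations of the positions `b (2 * j)`. -/
theorem exists_recorded (hG : G.Inflates game k f) (hf : Full k f (core n)) (hk : 0 < k)
    {M : Memo V} (hM : Memo.Closed G (2 ^ k - 1) M) (T : Finset ℕ) {Y : Set Pos}
    (h : Stage n (2 * m) Y) (hc : c (2 * m) ∈ Y) (hY : M (blk f Y) ≠ none) :
    ∃ Z, M (blk f Z) ≠ none ∧ (∀ j, 1 ≤ j → j ≤ m → (b (2 * j) ∈ Z ↔ j ∈ T)) ∧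
      ∀ j > 2 * m, b j ∈ Z ↔ b j ∈ Y := by
  induction m generalizing Y with
  | zero => exact ⟨Y, hY, by intros; omega, fun _ _ => Iff.rfl⟩
  | succ m ih =>
    have h : Stage n (2 * m + 1 + 1) Y := h
    have hc : c (2 * m + 1 + 1) ∈ Y := hc
    by_cases hT : m + 1 ∈ T
    · have hR := hM _ _ (h.forcedCall_right hc (by omega) hG hf hk) hY
      have hRL := hM _ _ (h.right.forcedCall_left hG hf hk) hR
      obtain ⟨Z, hZ, hbits, hrest⟩ := ih h.right.left h.right.left_c_mem hRL
      refine ⟨Z, hZ, fun j h1 h2 => ?_, fun j hj => ?_⟩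
      · rcases h2.lt_or_eq with h2 | rfl
        · exact hbits j h1 (by omega)
        · rw [hrest _ (by omega)]
          refine iff_of_true ⟨⟨h.ab _ h.a_mem, by simp [rightAttr]⟩, ?_⟩ hT
          simp only [Set.mem_insert_iff, Set.mem_singleton_iff, reduceCtorEq, false_or, b.injEq]
          omega
      · rw [hrest j (by omega)]
        have : j ≠ 2 * m + 1 := by omega
        simp [rightAttr, this]
    · have hL := hM _ _ (h.forcedCall_left hG hf hk) hY
      have hLL := hM _ _ (h.left.forcedCall_left hG hf hk) hL
      obtain ⟨Z, hZ, hbits, hrest⟩ := ih h.left.left h.left.left_c_mem hLL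
      refine ⟨Z, hZ, fun j h1 h2 => ?_, fun j hj => ?_⟩
      · rcases h2.lt_or_eq with h2 | rfl
        · exact hbits j h1 (by omega)
        · rw [hrest _ (by omega)]
          refine iff_of_false (fun hb => hb.1.2 (by simp; omega)) hT
      · rw [hrest j (by omega)]
        have h1 : j ≠ 2 * m + 1 := by omega
        have h2 : j ≠ 2 * m + 1 + 1 := by omega
        simp [h1, h2]

theorem two_pow_le_records (hG : G.Inflates game k f) (hf : Full k f (core (2 * m + 1)))
    (hk : 0 < k) {M : Memo V} (hM : Memo.Closed G (2 ^ k - 1) M)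
    (hY : M (blk f (core (2 * m + 1))) ≠ none) : 2 ^ m ≤ M.records.card := by
  classical
  choose Z hZ hbits _ using fun T => exists_recorded hG hf hk hM T (stage_core (2 * m))
    (Nat.lt_succ_self _) hY
  have hinj : Set.InjOn (fun T => blk f (Z T)) (Finset.Icc 1 m).powerset := by
    intro S hS T hT hST
    rw [Finset.mem_coe, Finset.mem_powerset] at hS hT
    ext j
    by_cases hj : j ∈ Finset.Icc 1 m
    · rw [Finset.mem_Icc] at hj
      rw [← hbits S j hj.1 hj.2, ← hbits T j hj.1 hj.2]
      obtain ⟨v, hv⟩ := hf (b (2 * j)) (by change 2 * j < 2 * m + 1; omega) 0 hk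
      have : v ∈ blk f (Z S) ↔ v ∈ blk f (Z T) := by
        have hST : blk f (Z S) = blk f (Z T) := hST
        rw [hST]
      rwa [mem_blk, mem_blk, hv] at this
    · exact iff_of_false (fun h => hj (hS h)) fun h => hj (hT h)
  have := Finset.card_le_card_of_injOn (t := M.records) _ (fun T _ => by
    simp only [Memo.records, Finset.coe_filter, Finset.mem_univ, true_and, Set.mem_ofPred_eq]
    exact hZ T) hinj
  simpa using this

/-! ### Padding and the lower bound for all runs. -/

/-- Padding positions are never entered and move to `hub false`, so every bottom component meets the
core. -/
theorem bottomSCC_univ (hG : G.Inflates game k f) (hf : Full k f (core n)) (hk : 0 < k)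
    (hran : ∀ v, (f v).1 ∈ core n ∨ f v = (pad, k - 1)) {C : Finset V}
    (hC : G.IsBottomSCC Finset.univ C) : C = blk f (core n) := by
  have hfc := (admissible_core n).full hf
  obtain ⟨w, hw⟩ := hfc (hub false) trivial 0 hk
  have hcore : G.IsBottomSCC Finset.univ (blk f (core n)) := by
    refine isBottomSCC_blk hG hfc ⟨w, mem_blk.2 (by rw [hw]; trivial)⟩
      (admissible_core n).transGen (Finset.subset_univ _) fun v hv x _ hm => ?_
    rw [mem_blk] at hv ⊢
    rcases hran x with hx | hx
    · exact hx
    · rw [hG.move, hx] at hm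
      rcases hm with ⟨h, -⟩ | ⟨-, -, h⟩
      · rw [hx, h]; exact hv
      · cases hu : (f v).1 <;> rw [hu] at h <;> exact h.elim
  obtain ⟨v, hv⟩ := hC.1
  rcases hran v with h | h
  · exact bottomSCC_unique hC hcore hv (mem_blk.2 h)
  · have hm : G.move v w := by
      rw [hG.move, h, hw]
      exact .inr ⟨by simp only; omega, rfl, rfl⟩
    exact bottomSCC_unique hC hcore (hC.closed hv (Finset.mem_univ _) hm)
      (mem_blk.2 (by rw [hw]; trivial))

/-- The padding forces a decomposition step that solves the core. With fewer than `2 ^ m` steps,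
hence fewer than `2 ^ (m + 1) - 1`, the table is closed under forced calls and has `2 ^ m` records,
more than the steps can pay for. -/
theorem two_pow_le_of_solvedIn (hG : G.Inflates game (m + 1) f)
    (hf : Full (m + 1) f (core (2 * m + 1)))
    (hran : ∀ v, (f v).1 ∈ core (2 * m + 1) ∨ f v = (pad, m))
    (hpad : ∃ v, f v = (pad, m)) {ℓ : ℕ → ℕ} {t : ℕ} (h : G.SolvedIn ℓ t) : 2 ^ m ≤ t := by
  obtain ⟨W, M, h⟩ := h
  have hbot := fun {C} => bottomSCC_univ (C := C) hG hf (Nat.succ_pos m) hran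
  have huniv : ¬ G.IsBottomSCC Finset.univ Finset.univ := by
    intro hu
    obtain ⟨v, hv⟩ := hpad
    have := Finset.mem_univ v
    rw [hbot hu, mem_blk, hv] at this
    exact this
  generalize hX : (Finset.univ : Finset V) = X at h
  cases h with
  | hit _ _ _ h => simp [Memo.empty] at h
  | empty =>
    obtain ⟨v, -⟩ := hpad
    have := Finset.mem_univ v
    rw [hX] at this
    simp at this
  | scc M M₁ M₂ X C W₁ W₂ t₁ t₂ _ _ hC _ e _ =>
    subst hX
    obtain rfl := hbot hC
    by_contra hlt
    have h1 : 2 ^ (m + 1) = 2 * 2 ^ m := pow_succ' 2 m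
    have hclosed : Memo.Closed G (2 ^ (m + 1) - 1) M₁ :=
      e.closed Memo.correct_empty (fun _ _ _ h => by simp [Memo.empty] at h) (by omega)
    have h2 := two_pow_le_records hG hf (Nat.succ_pos m) hclosed (e.recorded hC.1)
    have h3 := e.card_records
    have h4 : (Memo.empty : Memo V).records = ∅ := by simp [Memo.records, Memo.empty]
    rw [h4, Finset.card_empty] at h3
    omega
  | dominion _ _ _ _ _ _ _ _ _ _ _ hs => exact absurd (hX ▸ hs) huniv
  | left _ _ _ _ _ _ _ _ hs => exact absurd (hX ▸ hs) huniv
  | right _ _ _ _ _ _ _ _ _ _ _ hs => exact absurd (hX ▸ hs) huniv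

theorem exists_inflation (hf : Full k f (core n)) (hk : 0 < k)
    (hran : ∀ v, (f v).1 ∈ core n ∨ f v = (pad, k - 1)) (hlt : ∀ v, (f v).2 < k) :
    ∃ G : ParityGame V, G.Inflates game k f := by
  refine ⟨{
    owner := fun v => game.owner (f v).1
    priority := fun v => game.priority (f v).1
    move := fun v w => ((f w).1 = (f v).1 ∧ (f w).2 = (f v).2 + 1) ∨
      ((f v).2 + 1 = k ∧ (f w).2 = 0 ∧ game.move (f v).1 (f w).1)
    total := fun v => ?_ }, fun _ => rfl, fun _ => rfl, fun _ _ => Iff.rfl, hlt⟩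
  have := hlt v
  rcases hran v with h | h
  · by_cases ht : (f v).2 + 1 < k
    · obtain ⟨w, hw⟩ := hf _ h _ ht
      exact ⟨w, .inl (by rw [hw]; simp)⟩
    · obtain ⟨x, hx, hm⟩ := (admissible_core n).exists_move _ h
      obtain ⟨w, hw⟩ := hf x hx 0 hk
      exact ⟨w, .inr (by rw [hw]; exact ⟨by omega, rfl, hm⟩)⟩
  · obtain ⟨w, hw⟩ := hf (hub false) trivial 0 hk
    exact ⟨w, .inr (by rw [hw, h]; exact ⟨by simp only; omega, rfl, rfl⟩)⟩

/-- The elements of `core n`. -/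
def ofCode {n : ℕ} : (Fin n × Fin 4) ⊕ Bool → Pos
  | .inl (j, 0) => a j
  | .inl (j, 1) => b j
  | .inl (j, 2) => c j
  | .inl (j, 3) => d j
  | .inr q => hub q

theorem ofCode_mem {n : ℕ} (x : (Fin n × Fin 4) ⊕ Bool) : ofCode x ∈ core n := by
  rcases x with ⟨j, x⟩ | q
  · fin_cases x <;> exact j.2
  · trivial

theorem exists_ofCode {n : ℕ} {u : Pos} (hu : u ∈ core n) :
    ∃ x : (Fin n × Fin 4) ⊕ Bool, ofCode x = u := by
  cases u with
  | hub q => exact ⟨.inr q, rfl⟩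
  | a j => exact ⟨.inl (⟨j, hu⟩, 0), rfl⟩
  | b j => exact ⟨.inl (⟨j, hu⟩, 1), rfl⟩
  | c j => exact ⟨.inl (⟨j, hu⟩, 2), rfl⟩
  | d j => exact ⟨.inl (⟨j, hu⟩, 3), rfl⟩
  | pad => exact hu.elim

/-- The inflated core has `2 * m + 1` levels of four positions and two hubs, each with `m + 1`
copies. The strict inequality leaves at least one padding position. The index `m` makes it the end
of a path, so that it moves straight to the core. -/
theorem exists_naming (m N : ℕ) (hN : (8 * m + 6) * (m + 1) < N) :
    ∃ f : Fin N → Pos × ℕ, Full (m + 1) f (core (2 * m + 1)) ∧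
      (∀ v, (f v).1 ∈ core (2 * m + 1) ∨ f v = (pad, m)) ∧ (∃ v, f v = (pad, m)) ∧
      ∀ v, (f v).2 < m + 1 := by
  obtain ⟨r, hr⟩ := Nat.exists_eq_add_of_lt hN
  let T := (((Fin (2 * m + 1) × Fin 4) ⊕ Bool) × Fin (m + 1)) ⊕ Fin (r + 1)
  have hT : Fintype.card T = N := by
    simp only [T, Fintype.card_sum, Fintype.card_prod, Fintype.card_fin, Fintype.card_bool]
    rw [hr]; ring
  let e : T ≃ Fin N := Fintype.equivFinOfCardEq hT
  let g : T → Pos × ℕ := Sum.elim (fun x => (ofCode x.1, (x.2 : ℕ))) fun _ => (pad, m)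
  refine ⟨fun v => g (e.symm v), fun u hu t ht => ?_, fun v => ?_, ⟨e (.inr 0), ?_⟩, fun v => ?_⟩
  · obtain ⟨x, rfl⟩ := exists_ofCode hu
    exact ⟨e (.inl (x, ⟨t, ht⟩)), by simp [g]⟩
  · beta_reduce
    rcases e.symm v with x | x
    · exact .inl (ofCode_mem _)
    · exact .inr rfl
  · simp [g]
  · beta_reduce
    rcases e.symm v with x | x
    · exact x.2.2
    · exact Nat.lt_succ_self m

end Pos

theorem exists_hard_game (m N : ℕ) (hN : (8 * m + 6) * (m + 1) < N) :
    ∃ G : ParityGame (Fin N), ∀ (ℓ : ℕ → ℕ) (t : ℕ), G.SolvedIn ℓ t → 2 ^ m ≤ t := by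
  obtain ⟨f, hf, hran, hpad, hlt⟩ := Pos.exists_naming m N hN
  obtain ⟨G, hG⟩ := Pos.exists_inflation hf (Nat.succ_pos m) hran hlt
  exact ⟨G, fun ℓ t h => Pos.two_pow_le_of_solvedIn hG hf hran hpad h⟩

end ParityGame

theorem corollary1 :
    ∃ c : ℝ, 0 < c ∧ ∀ᶠ n : ℕ in Filter.atTop, ∃ G : ParityGame (Fin n), ∀ ℓ : ℕ → ℕ,
      (∃ t : ℕ, G.SolvedIn ℓ t) ∧
      ∀ t : ℕ, G.SolvedIn ℓ t → (2 : ℝ) ^ (c * Real.sqrt (n : ℝ)) ≤ (t : ℝ) := by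
  -- The exponent works because `√n ≤ 6 * m + 6 ≤ 12 * m` for the `m` below.
  refine ⟨1 / 12, by norm_num, ?_⟩
  filter_upwards [eventually_ge_atTop 196] with n hn
  -- Since `m ≥ 1`, the core fits: `(8 * m + 6) * (m + 1) ≤ 28 * m ^ 2 < 36 * m ^ 2 ≤ n`.
  set m := Nat.sqrt n / 6 with hm
  have h14 : 14 ≤ Nat.sqrt n := Nat.le_sqrt.2 (by omega)
  have hm1 : 1 ≤ m := by omega
  have hsq : (6 * m) * (6 * m) ≤ n :=
    (Nat.mul_self_le_mul_self (by omega)).trans (Nat.sqrt_le n)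
  obtain ⟨G, hG⟩ := ParityGame.exists_hard_game m n (by nlinarith)
  refine ⟨G, fun ℓ => ⟨?_, fun t ht => ?_⟩⟩
  · obtain ⟨W, M, t, h⟩ := G.exists_exec ℓ ParityGame.Memo.empty Finset.univ
      ParityGame.Memo.correct_empty
    exact ⟨t, W, M, h⟩
  · have h1 : Real.sqrt n ≤ 6 * m + 6 := by
      have h2 : Nat.sqrt n + 1 ≤ 6 * m + 6 := by omega
      have h3 : ((Nat.sqrt n + 1 : ℕ) : ℝ) ≤ ((6 * m + 6 : ℕ) : ℝ) := by exact_mod_cast h2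
      have h4 := Real.real_sqrt_le_nat_sqrt_succ (a := n)
      push_cast at h3
      linarith
    have h5 : (1 : ℝ) ≤ m := by exact_mod_cast hm1
    calc (2 : ℝ) ^ (1 / 12 * Real.sqrt n) ≤ (2 : ℝ) ^ (m : ℝ) :=
          Real.rpow_le_rpow_of_exponent_le (by norm_num) (by linarith)
      _ = ((2 ^ m : ℕ) : ℝ) := by rw [Real.rpow_natCast]; push_cast; rfl
      _ ≤ t := by exact_mod_cast hG ℓ t ht
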